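/- **Setting.** Let $Y_i=\theta_i+\epsilon_i$, $i=1,\dots,n$, where $\theta\in\mathbb{R}^n$ and $\epsilon_1,\dots,\epsilon_n$ are independent, centred and sub-Gaussian: $\mathbb{E}[e^{t\epsilon_i}]\le e^{t^2/2}$ for all $t\in\mathbb{R}$. A change-point vector is a vector of integers $\tau=(\tau_1<\dots<\tau_{|\tau|})$ of any length $|\tau|\ge 0$ with $1=\tau_0<\tau_1$ and $\tau_{|\tau|}<\tau_{|\tau|+1}=n+1$. Let $\tau^*=(\tau^*_1,\dots,\tau^*_K)$ be the change-point vector of $\theta$, i.e. $\theta_i=\mu_k$ for $\tau^*_{k-1}\le i<\tau^*_k$ with $\mu_k\ne\mu_{k+1}$, and let $\Delta_k=\mu_{k+1}-\mu_k$. For integers $1\le t_1<t_2<t_3\le n+1$, $t=(t_1,t_2,t_3)$ and $v\in\mathbb{R}^n$ put $$\mathbf{C}(v,t)=\Big[\tfrac{\sum_{i=t_2}^{t_3-1}v_i}{t_3-t_2}-\tfrac{\sum_{i=t_1}^{t_2-1}v_i}{t_2-t_1}\Big]\sqrt{\tfrac{(t_2-t_1)(t_3-t_2)}{t_3-t_1}},\qquad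 \psi_q(t)=\sqrt{2\log\Big(\tfrac{n(t_3-t_1)}{(t_3-t_2)(t_2-t_1)}\Big)+q}.$$ The change-point $\tau^*_k$ is $(\kappa,q)$-high-energy if $|\mathbf{C}(\theta,(\tau^*_{k-1},\tau^*_k,\tau^*_{k+1}))|>\kappa\,\psi_q(\tau^*_{k-1},\tau^*_k,\tau^*_{k+1})$. Given $L>1$ and $q>0$, the penalized least-squares estimator $\widehat\tau$ is any minimizer, over all change-point vectors $\tau$, of $$\|Y-\Pi_\tau Y\|^2+L\Big[q|\tau|+2\sum_{i=1}^{|\tau|+1}\log\Big(\frac{n}{\tau_i-\tau_{i-1}}\Big)\Big],$$ where $\Pi_\tau$ is the orthogonal projector onto the vectors that are constant on each $\{\tau_i,\dots,\tau_{i+1}-1\}$. Put $\ell=\min\{(\sqrt L+9)/10,\,2\}$ and let $\mathcal{A}_{L,q}$ be the event that $|\mathbf{C}(\epsilon,t)|\le \ell\,\psi_q(t)$ for all $t=(t_1,t_2,t_3)$ as above. Let $d_{H,1}(\tau,t')=\min_l|\tau_l-t'|$ (equal to $+\infty$ if $\tau$ is empty), and $y_+=\max(y,0)$. **Proposition 10.**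 There exist universal constants $q'_0,c_1,c,c'>0$ such that for every $L>1$ there exists $\kappa_L>1$, depending only on $L$, with the following property. For every $q>q'_0+c_1\log\big[((L\wedge 2)-1)^{-1}\big]$, every $n$, every $\theta\in\mathbb{R}^n$, every noise vector as above, every penalized least-squares estimator $\widehat\tau$ and every $(\kappa_L,q)$-high-energy change-point $\tau^*_k$ of $\theta$, $$\mathbb{P}\left(d_{H,1}(\widehat\tau,\tau^*_k)\,\mathbf{1}_{\mathcal{A}_{L,q}}\ \ge\ c\,x\,\Delta_k^{-2}\right)\le c'e^{-x}$$ for every $x\ge 1+(\log(L-1))_+$, and likewise for every $x\ge 1+(\log((L-1)^{-1}))_+$. -/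

import Mathlib

open MeasureTheory ProbabilityTheory

/-- A change-point vector `(τ_1 < ⋯ < τ_m)` for `n` observations, stored together with the
conventional end points: `pos 0 = τ_0 = 1` and `pos (m + 1) = τ_{m+1} = n + 1`. -/
structure ChangePointVector (n : ℕ) where
  len : ℕ
  pos : Fin (len + 2) → ℕ
  strictMono : StrictMono pos
  pos_zero : pos 0 = 1
  pos_last : pos (Fin.last (len + 1)) = n + 1

namespace ChangePointVector

variable {n : ℕ}

/-- The change-point with (zero-based) index `k`, that is `τ_{k+1}`. -/
def point (τ : ChangePointVector n) (k : Fin τ.len) : ℕ := τ.pos k.succ.castSucc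

/-- The left neighbour of `τ.point k` (possibly the end point `1`). -/
def prev (τ : ChangePointVector n) (k : Fin τ.len) : ℕ := τ.pos k.castSucc.castSucc

/-- The right neighbour of `τ.point k` (possibly the end point `n + 1`). -/
def next (τ : ChangePointVector n) (k : Fin τ.len) : ℕ := τ.pos k.succ.succ

end ChangePointVector

/-- The coordinate `i : Fin n` is the time `i + 1` in `{1, …, n}`; `InSegment a b i` says that this
time lies in `[a, b)`. -/
def InSegment {n : ℕ} (a b : ℕ) (i : Fin n) : Prop := a ≤ (i : ℕ) + 1 ∧ (i : ℕ) + 1 < b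

instance {n : ℕ} (a b : ℕ) (i : Fin n) : Decidable (InSegment a b i) :=
  inferInstanceAs (Decidable (_ ∧ _))

/-- `∑_{i=a}^{b-1} v_i`. -/
noncomputable def segmentSum {n : ℕ} (v : Fin n → ℝ) (a b : ℕ) : ℝ :=
  ∑ i : Fin n, if InSegment a b i then v i else 0

/-- The CUSUM statistic `C(v, (t₁, t₂, t₃))`. For the noise vector it is `N(t)`. -/
noncomputable def cusum {n : ℕ} (v : Fin n → ℝ) (t₁ t₂ t₃ : ℕ) : ℝ :=
  (segmentSum v t₂ t₃ / ((t₃ : ℝ) - t₂) - segmentSum v t₁ t₂ / ((t₂ : ℝ) - t₁)) *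
    √((((t₂ : ℝ) - t₁) * ((t₃ : ℝ) - t₂)) / ((t₃ : ℝ) - t₁))

/-- The energy `E(θ, (t₁, t₂, t₃))`. -/
noncomputable def energy {n : ℕ} (θ : Fin n → ℝ) (t₁ t₂ t₃ : ℕ) : ℝ := |cusum θ t₁ t₂ t₃|

/-- `ψ_q(t₂ - t₁, t₃ - t₂)`, for `n` observations. -/
noncomputable def psi (n : ℕ) (q : ℝ) (t₁ t₂ t₃ : ℕ) : ℝ :=
  √(2 * Real.log (((n : ℝ) * ((t₃ : ℝ) - t₁)) / (((t₃ : ℝ) - t₂) * ((t₂ : ℝ) - t₁))) + q)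

/-- `θ` has change-points vector `τ` and takes the values `m`, with `m_k ≠ m_{k+1}`. -/
structure HasChangePoints {n : ℕ} (θ : Fin n → ℝ) (τ : ChangePointVector n)
    (m : Fin (τ.len + 1) → ℝ) : Prop where
  eq_sum : ∀ i : Fin n, θ i =
    ∑ k : Fin (τ.len + 1), if InSegment (τ.pos k.castSucc) (τ.pos k.succ) i then m k else 0
  ne : ∀ k : Fin τ.len, m k.castSucc ≠ m k.succ

/-- The height `Δ_k` of a change-point. -/
def height {n : ℕ} {τ : ChangePointVector n} (m : Fin (τ.len + 1) → ℝ) (k : Fin τ.len) : ℝ :=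
  m k.succ - m k.castSucc

/-- `τ_k` is a `(κ, q)`-high-energy change-point of `θ`. -/
def IsHighEnergy {n : ℕ} (κ q : ℝ) (θ : Fin n → ℝ) (τ : ChangePointVector n)
    (k : Fin τ.len) : Prop :=
  κ * psi n q (τ.prev k) (τ.point k) (τ.next k) <
    energy θ (τ.prev k) (τ.point k) (τ.next k)

/-- The space of vectors that are constant on each segment `[τ_i, τ_{i+1})`. -/
def piecewiseConstant {n : ℕ} (τ : ChangePointVector n) :
    Submodule ℝ (EuclideanSpace ℝ (Fin n)) where
  carrier := {v | ∀ k : Fin (τ.len + 1), ∀ i j : Fin n,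
    InSegment (τ.pos k.castSucc) (τ.pos k.succ) i →
    InSegment (τ.pos k.castSucc) (τ.pos k.succ) j → v i = v j}
  zero_mem' := fun _ _ _ _ _ => rfl
  add_mem' := fun {v w} hv hw k i j hi hj => by
    simp only [PiLp.add_apply, hv k i j hi hj, hw k i j hi hj]
  smul_mem' := fun a v hv k i j hi hj => by
    simp only [PiLp.smul_apply, hv k i j hi hj]

/-- The multiscale penalty `pen₀(τ, q)`. -/
noncomputable def penalty {n : ℕ} (q : ℝ) (τ : ChangePointVector n) : ℝ :=
  q * τ.len + 2 * ∑ i : Fin (τ.len + 1),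
    Real.log ((n : ℝ) / ((τ.pos i.succ : ℝ) - (τ.pos i.castSucc : ℝ)))

/-- The penalized least-squares criterion `Cr₀(Y, τ) = ‖Y - Π_τ Y‖² + L pen₀(τ, q)`. -/
noncomputable def criterion {n : ℕ} (L q : ℝ) (Y : Fin n → ℝ) (τ : ChangePointVector n) : ℝ :=
  ‖WithLp.toLp 2 Y - (piecewiseConstant τ).starProjection (WithLp.toLp 2 Y)‖ ^ 2
    + L * penalty q τ

/-- `τ` is a penalized least-squares estimate computed from the data `Y`. -/
def IsPenalizedLeastSquares {n : ℕ} (L q : ℝ) (Y : Fin n → ℝ) (τ : ChangePointVector n) : Prop :=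
  ∀ τ' : ChangePointVector n, criterion L q Y τ ≤ criterion L q Y τ'

/-- `d_{H,1}(τ, t)`: the distance from `t` to the closest entry of `τ`; it is infinite when `τ` has
no entry. -/
noncomputable def distTo {n : ℕ} (τ : ChangePointVector n) (t : ℕ) : ENNReal :=
  ⨅ l : Fin τ.len, ENNReal.ofReal |(τ.point l : ℝ) - (t : ℝ)|

/-- The factor `ℓ = ((√L + 9) / 10) ∧ 2`. -/
noncomputable def ell (L : ℝ) : ℝ := min ((√L + 9) / 10) 2

/-- The event `A_{L,q}`: `|N(t)| ≤ ℓ ψ_q(δ(t))` for all triads `1 ≤ t₁ < t₂ < t₃ ≤ n + 1`. -/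
def goodEvent {Ω : Type*} {n : ℕ} (L q : ℝ) (ε : Fin n → Ω → ℝ) : Set Ω :=
  {ω | ∀ t₁ t₂ t₃ : ℕ, 1 ≤ t₁ → t₁ < t₂ → t₂ < t₃ → t₃ ≤ n + 1 →
    |cusum (fun i => ε i ω) t₁ t₂ t₃| ≤ ell L * psi n q t₁ t₂ t₃}

/-- The noise variables are independent, centred and sub-Gaussian with constant `1`:
`E[exp(t ε_i)] ≤ exp(t² / 2)` for all real `t`. -/
structure IsNoise {Ω : Type*} [MeasurableSpace Ω] {n : ℕ} (P : Measure Ω)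
    (ε : Fin n → Ω → ℝ) : Prop where
  measurable : ∀ i, Measurable (ε i)
  indep : iIndepFun ε P
  centred : ∀ i, ∫ ω, ε i ω ∂P = 0
  subgaussian : ∀ i, HasSubgaussianMGF (ε i) 1 P

/-! Write `T` for the change-point, `s` and `t` for its neighbours, `Δ` for its height, `m` for the
length of the shorter adjacent segment, and `d = 3200 x / Δ²`. Randomness enters twice: through the
good event, and through the event that the noise averages over all stretches of length at least `d`
ending or starting at `T` are at most `|Δ| / 40`. The latter fails with probability at most `4 exp
(-x)`, by a maximal inequality for exponential supermartingales
(`measureReal_exists_abs_sum_ge_le`). The rest is deterministic: on both events an estimator with no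
entry within `d` of `T` is not optimal (`MissedChangePoint.not_missed`). The criterion is a sum over
fitted segments, so a stretch of the estimator may be replaced without touching the rest, and
splitting a segment changes the cost by `L ψ²` minus a squared CUSUM (`segCost_split`). High energy
forces some entry within `δ m` of `T`, since otherwise inserting `T` and at most two auxiliary
points pays (`exists_near`). Let `b < T < c` be the neighbouring entries, `c` the closer one by
reflection. Entries that close to `T` can be removed once `T` is inserted, saving about one penalty
term (`exists_removal_left`). If both `b` and `c` are within order `L / Δ²`, replacing both by `T`
saves two penalties for one (`false_of_bracket`). Otherwise `c` alone is replaced, and the CUSUM at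
`(b, T, c)`, of order `Δ² (c - T)`, beats all errors (`false_of_right_closer`). -/

/-! ### Maximal inequality for sub-Gaussian walks. -/

section Maximal

variable {Ω ι : Type*} [MeasurableSpace Ω] {P : Measure Ω}

/-- One step of the exponential supermartingale: the compensator `a² / 2` is exactly what the
sub-Gaussian bound allows. -/
theorem lintegral_exp_subgaussian_le_one {X : Ω → ℝ} (h : HasSubgaussianMGF X 1 P) (a : ℝ) :
    ∫⁻ ω, ENNReal.ofReal (Real.exp (a * X ω - a ^ 2 / 2)) ∂P ≤ 1 := by
  have h1 : ∀ ω, Real.exp (a * X ω - a ^ 2 / 2) = Real.exp (a * X ω) * Real.exp (-(a ^ 2 / 2)) := by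
    intro ω
    rw [← Real.exp_add, sub_eq_add_neg]
  simp_rw [h1]
  rw [← ofReal_integral_eq_lintegral_ofReal ((h.integrable_exp_mul a).mul_const _)
    (Filter.Eventually.of_forall fun ω => by positivity), integral_mul_const]
  have h2 := h.mgf_le a
  rw [mgf] at h2
  refine ENNReal.ofReal_le_one.2 ?_
  calc _ ≤ Real.exp ((1 : NNReal) * a ^ 2 / 2) * Real.exp (-(a ^ 2 / 2)) :=
        mul_le_mul_of_nonneg_right h2 (Real.exp_pos _).le
    _ = 1 := by rw [← Real.exp_add]; simp

/-- The exponential walk `a ∑_{l < j} x_l - j a² / 2`. -/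
noncomputable def tiltedWalk (a : ℝ) (x : ℕ → ℝ) (j : ℕ) : ℝ :=
  a * ∑ l ∈ Finset.range j, x l - j * (a ^ 2 / 2)

theorem tiltedWalk_succ (a : ℝ) (x : ℕ → ℝ) (j : ℕ) :
    tiltedWalk a x (j + 1) = tiltedWalk a x j + (a * x j - a ^ 2 / 2) := by
  simp only [tiltedWalk, Finset.sum_range_succ]
  push_cast
  ring

theorem tiltedWalk_congr (a : ℝ) {x x' : ℕ → ℝ} {j : ℕ} (h : ∀ l < j, x l = x' l) :
    tiltedWalk a x j = tiltedWalk a x' j := by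
  simp only [tiltedWalk]
  rw [Finset.sum_congr rfl fun l hl => h l (Finset.mem_range.1 hl)]

theorem measurable_tiltedWalk (a : ℝ) (j : ℕ) : Measurable fun x => tiltedWalk a x j := by
  unfold tiltedWalk
  fun_prop

/-- Sequences whose tilted walk stays below `y` up to time `j`. -/
def staysBelow (a y : ℝ) (j : ℕ) : Set (ℕ → ℝ) := {x | ∀ i ≤ j, tiltedWalk a x i < y}

theorem measurableSet_staysBelow (a y : ℝ) (j : ℕ) : MeasurableSet (staysBelow a y j) := by
  have : staysBelow a y j = ⋂ i, ⋂ (_ : i ≤ j), {x | tiltedWalk a x i < y} := by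
    ext x; simp [staysBelow]
  rw [this]
  exact MeasurableSet.iInter fun i => MeasurableSet.iInter fun _ =>
    measurableSet_lt (measurable_tiltedWalk a i) measurable_const

/-- The supermartingale property before crossing: the past depends on the first `j` variables only,
the new factor is independent of them and has mean at most one. -/
theorem lintegral_staysBelow_succ_le [IsProbabilityMeasure P] {ε : ι → Ω → ℝ}
    (hm : ∀ i, Measurable (ε i)) (hi : iIndepFun ε P) (hs : ∀ i, HasSubgaussianMGF (ε i) 1 P)
    (e : ℕ → ι) {j : ℕ} (he : ∀ l < j, e l ≠ e j) (a y : ℝ) :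
    ∫⁻ ω, (staysBelow a y j).indicator
        (fun x => ENNReal.ofReal (Real.exp (tiltedWalk a x (j + 1)))) (fun l => ε (e l) ω) ∂P ≤
      ∫⁻ ω, (staysBelow a y j).indicator
        (fun x => ENNReal.ofReal (Real.exp (tiltedWalk a x j))) (fun l => ε (e l) ω) ∂P := by
  classical
  set ψ : (ℕ → ℝ) → ENNReal := (staysBelow a y j).indicator
        (fun x => ENNReal.ofReal (Real.exp (tiltedWalk a x j))) with hψ
  have hψm : Measurable ψ := by
    refine Measurable.indicator ?_ (measurableSet_staysBelow a y j)
    exact ENNReal.measurable_ofReal.comp (Real.measurable_exp.comp (measurable_tiltedWalk a j))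
  have hψc : ∀ x x' : ℕ → ℝ, (∀ l < j, x l = x' l) → ψ x = ψ x' := by
    intro x x' h
    have h1 : ∀ i ≤ j, tiltedWalk a x i = tiltedWalk a x' i := fun i hi =>
      tiltedWalk_congr a fun l hl => h l (by omega)
    have h2 : x ∈ staysBelow a y j ↔ x' ∈ staysBelow a y j := by
      exact forall₂_congr fun i hi => by rw [h1 i hi]
    by_cases hx : x ∈ staysBelow a y j
    · rw [hψ, Set.indicator_of_mem hx, Set.indicator_of_mem (h2.1 hx), h1 j le_rfl]
    · rw [hψ, Set.indicator_of_notMem hx, Set.indicator_of_notMem (fun h => hx (h2.2 h))]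
  set g : ℝ → ENNReal := fun z => ENNReal.ofReal (Real.exp (a * z - a ^ 2 / 2)) with hg
  have hgm : Measurable g := by rw [hg]; fun_prop
  have hsplit : ∀ ω, (staysBelow a y j).indicator
        (fun x => ENNReal.ofReal (Real.exp (tiltedWalk a x (j + 1)))) (fun l => ε (e l) ω) =
      ψ (fun l => ε (e l) ω) * g (ε (e j) ω) := by
    intro ω
    by_cases hx : (fun l => ε (e l) ω) ∈ staysBelow a y j
    · rw [hψ, Set.indicator_of_mem hx, Set.indicator_of_mem hx, tiltedWalk_succ, Real.exp_add,
        ENNReal.ofReal_mul (Real.exp_pos _).le]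
    · rw [hψ, Set.indicator_of_notMem hx, Set.indicator_of_notMem hx, zero_mul]
  simp_rw [hsplit]
  set S := (Finset.range j).image e with hS
  -- Extension by zero from the finitely many past variables to a sequence; the zeros are harmless
  -- because `ψ` reads only the first `j` entries.
  set r : (S → ℝ) → ℕ → ℝ := fun v l => if h : e l ∈ S then v ⟨e l, h⟩ else 0 with hr
  have hrm : Measurable r := by
    refine measurable_pi_lambda _ fun l => ?_
    by_cases h : e l ∈ S
    · simp only [hr, h, dif_pos]; exact measurable_pi_apply _
    · simp only [hr, h, dif_neg, not_false_eq_true]; exact measurable_const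
  have hrψ : ∀ ω, ψ (fun l => ε (e l) ω) = ψ (r fun i : S => ε i ω) := by
    intro ω
    refine hψc _ _ fun l hl => ?_
    have : e l ∈ S := Finset.mem_image_of_mem _ (Finset.mem_range.2 hl)
    simp [hr, this]
  have hdisj : Disjoint S {e j} := by
    rw [Finset.disjoint_singleton_right, hS, Finset.mem_image]
    rintro ⟨l, hl, hle⟩
    exact he l (Finset.mem_range.1 hl) hle
  have hind := hi.indepFun_finset S {e j} hdisj hm
  have hgp : Measurable fun v : (({e j} : Finset ι) → ℝ) =>
      g (v ⟨e j, Finset.mem_singleton_self _⟩) := hgm.comp (measurable_pi_apply _)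
  have hind2 : IndepFun (fun ω => ψ (fun l => ε (e l) ω)) (fun ω => g (ε (e j) ω)) P := by
    have := hind.comp (φ := fun v => ψ (r v))
      (ψ := fun v => g (v ⟨e j, Finset.mem_singleton_self _⟩)) (hψm.comp hrm) hgp
    simp_rw [hrψ]
    exact this
  rw [show (fun ω => ψ (fun l => ε (e l) ω) * g (ε (e j) ω)) =
    (fun ω => ψ (fun l => ε (e l) ω)) * (fun ω => g (ε (e j) ω)) from rfl]
  have hψX : Measurable fun ω => ψ (fun l => ε (e l) ω) :=
    hψm.comp (measurable_pi_lambda _ fun l => hm (e l))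
  have hgX : Measurable fun ω => g (ε (e j) ω) := hgm.comp (hm (e j))
  rw [lintegral_mul_eq_lintegral_mul_lintegral_of_indepFun hψX hgX hind2]
  calc _ ≤ (∫⁻ ω, ψ (fun l => ε (e l) ω) ∂P) * 1 := by
        gcongr
        exact lintegral_exp_subgaussian_le_one (hs (e j)) a
    _ = _ := mul_one _

/-- The maximal inequality for the exponential supermartingale of a sub-Gaussian walk. -/
theorem measure_tiltedWalk_ge_le [IsProbabilityMeasure P] {ε : ι → Ω → ℝ}
    (hm : ∀ i, Measurable (ε i)) (hi : iIndepFun ε P) (hs : ∀ i, HasSubgaussianMGF (ε i) 1 P)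
    (e : ℕ → ι) {N : ℕ} (he : Set.InjOn e (Set.Iio N)) (a y : ℝ) :
    P {ω | ∃ j ≤ N, y ≤ tiltedWalk a (fun l => ε (e l) ω) j} ≤
      ENNReal.ofReal (Real.exp (-y)) := by
  set X : Ω → ℕ → ℝ := fun ω l => ε (e l) ω with hX
  have hXm : Measurable X := measurable_pi_lambda _ fun l => hm (e l)
  have hB : ∀ j, MeasurableSet (X ⁻¹' staysBelow a y j) := fun j =>
    hXm (measurableSet_staysBelow a y j)
  set Z : ℕ → Ω → ENNReal := fun j ω =>
    ENNReal.ofReal (Real.exp (tiltedWalk a (X ω) j)) with hZ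
  have hZm : ∀ j, Measurable (Z j) := fun j =>
    ENNReal.measurable_ofReal.comp (Real.measurable_exp.comp ((measurable_tiltedWalk a j).comp hXm))
  -- Optional stopping at the first crossing, written as an invariant: crossed mass weighted by `exp
  -- y`, plus the expectation on the uncrossed part, never increases.
  have key : ∀ j ≤ N, ENNReal.ofReal (Real.exp y) * P (X ⁻¹' staysBelow a y j)ᶜ +
      ∫⁻ ω, (X ⁻¹' staysBelow a y j).indicator (Z j) ω ∂P ≤ 1 := by
    intro j
    induction j with
    | zero =>
      intro _
      by_cases hy : 0 < y
      · have : X ⁻¹' staysBelow a y 0 = Set.univ := by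
          ext ω; simp [staysBelow, tiltedWalk, hy]
        rw [this]
        simp [hZ, tiltedWalk]
      · have : X ⁻¹' staysBelow a y 0 = ∅ := by
          ext ω; simpa [staysBelow, tiltedWalk] using hy
        rw [this]
        simpa using hy
    | succ j ih =>
      intro hj
      refine le_trans ?_ (ih (by omega))
      have hsub : X ⁻¹' staysBelow a y (j + 1) ⊆ X ⁻¹' staysBelow a y j :=
        fun ω h i hi => h i (by omega)
      -- On `D` the walk crosses for the first time at `j + 1`, where `Z (j + 1)` is at least `exp
      -- y`.
      set D := X ⁻¹' staysBelow a y j \ X ⁻¹' staysBelow a y (j + 1) with hD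
      have hDm : MeasurableSet D := (hB j).diff (hB (j + 1))
      have h1 : (X ⁻¹' staysBelow a y (j + 1))ᶜ = (X ⁻¹' staysBelow a y j)ᶜ ∪ D := by
        ext ω
        have := @hsub ω
        simp only [hD, Set.mem_compl_iff, Set.mem_union, Set.mem_sdiff]
        tauto
      have h2 : P (X ⁻¹' staysBelow a y (j + 1))ᶜ = P (X ⁻¹' staysBelow a y j)ᶜ + P D := by
        rw [h1]
        refine measure_union ?_ hDm
        exact Set.disjoint_left.2 fun ω h h' => h h'.1
      have h3 : ENNReal.ofReal (Real.exp y) * P D +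
          ∫⁻ ω, (X ⁻¹' staysBelow a y (j + 1)).indicator (Z (j + 1)) ω ∂P ≤
          ∫⁻ ω, (X ⁻¹' staysBelow a y j).indicator (Z (j + 1)) ω ∂P := by
        rw [← setLIntegral_const, ← lintegral_indicator hDm,
          ← lintegral_add_right _ ((hZm (j + 1)).indicator (hB (j + 1)))]
        refine lintegral_mono fun ω => ?_
        by_cases h : ω ∈ X ⁻¹' staysBelow a y j
        · by_cases h' : ω ∈ X ⁻¹' staysBelow a y (j + 1)
          · simp [hD, Set.indicator, h, h']
          · rw [Set.indicator_of_mem (show ω ∈ D from ⟨h, h'⟩), Set.indicator_of_notMem h',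
              Set.indicator_of_mem h, add_zero]
            refine ENNReal.ofReal_le_ofReal (Real.exp_le_exp.2 ?_)
            by_contra hlt
            refine h' fun i hi => ?_
            rcases Nat.lt_or_ge j i with hji | hji
            · obtain rfl : i = j + 1 := by omega
              exact not_le.1 hlt
            · exact h i hji
        · have h' : ω ∉ X ⁻¹' staysBelow a y (j + 1) := fun h' => h (hsub h')
          simp [hD, Set.indicator, h, h']
      have h4 := lintegral_staysBelow_succ_le hm hi hs e (j := j)
        (fun l hl heq => absurd (he (by simp; omega) (by simp; omega) heq) (by omega)) a y
      rw [h2, mul_add, add_assoc]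
      exact add_le_add le_rfl (h3.trans h4)
  have hset : {ω | ∃ j ≤ N, y ≤ tiltedWalk a (X ω) j} = (X ⁻¹' staysBelow a y N)ᶜ := by
    ext ω
    simp [staysBelow]
  have h5 := (le_add_right le_rfl).trans (key N le_rfl)
  rw [← hset] at h5
  calc _ = ENNReal.ofReal (Real.exp (-y)) * (ENNReal.ofReal (Real.exp y) *
        P {ω | ∃ j ≤ N, y ≤ tiltedWalk a (X ω) j}) := by
        rw [← mul_assoc, ← ENNReal.ofReal_mul (Real.exp_pos _).le, ← Real.exp_add,
          neg_add_cancel, Real.exp_zero, ENNReal.ofReal_one, one_mul]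
    _ ≤ ENNReal.ofReal (Real.exp (-y)) * 1 := by gcongr
    _ = _ := mul_one _

/-- The probability that the empirical mean of some initial stretch of length at least `d` exceeds
`a` decreases exponentially with `a² d`. -/
theorem measureReal_exists_abs_sum_ge_le [IsProbabilityMeasure P] {ε : ι → Ω → ℝ}
    (hm : ∀ i, Measurable (ε i)) (hi : iIndepFun ε P) (hs : ∀ i, HasSubgaussianMGF (ε i) 1 P)
    (e : ℕ → ι) {N : ℕ} (he : Set.InjOn e (Set.Iio N)) (a d : ℝ) (ha : 0 ≤ a) :
    P.real {ω | ∃ j ≤ N, d ≤ j ∧ a * j < |∑ l ∈ Finset.range j, ε (e l) ω|} ≤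
      2 * Real.exp (-(a ^ 2 * d / 2)) := by
  have h : ∀ b : ℝ, P.real {ω | ∃ j ≤ N, a ^ 2 * d / 2 ≤ tiltedWalk b (fun l => ε (e l) ω) j} ≤
      Real.exp (-(a ^ 2 * d / 2)) := fun b =>
    ENNReal.toReal_le_of_le_ofReal (Real.exp_pos _).le
      (measure_tiltedWalk_ge_le hm hi hs e he b _)
  rw [two_mul]
  refine le_trans ?_ (add_le_add (h a) (h (-a)))
  refine le_trans (measureReal_mono ?_) (measureReal_union_le _ _)
  rintro ω ⟨j, hj, hd, habs⟩
  -- A sum above `a j` lifts the walk tilted by `a` to `a² j - a² j / 2 ≥ a² d / 2`; a sum below `-a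
  -- j` does the same for the tilt `-a`.
  rcases lt_abs.1 habs with h1 | h1
  · left
    refine ⟨j, hj, ?_⟩
    simp only [tiltedWalk]
    nlinarith [mul_le_mul_of_nonneg_left h1.le ha, mul_le_mul_of_nonneg_left hd (sq_nonneg a)]
  · right
    refine ⟨j, hj, ?_⟩
    simp only [tiltedWalk]
    nlinarith [mul_le_mul_of_nonneg_left h1.le ha, mul_le_mul_of_nonneg_left hd (sq_nonneg a)]

end Maximal

/-! ### Additive costs along lists, and time reversal. -/

section PathCost

/-- The sum of `G` over consecutive pairs of a list. -/
def pathCost (G : ℤ → ℤ → ℝ) : List ℤ → ℝ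
  | [] => 0
  | [_] => 0
  | a :: b :: l => G a b + pathCost G (b :: l)

@[simp] theorem pathCost_nil (G : ℤ → ℤ → ℝ) : pathCost G [] = 0 := rfl

@[simp] theorem pathCost_singleton (G : ℤ → ℤ → ℝ) (a : ℤ) : pathCost G [a] = 0 := rfl

@[simp] theorem pathCost_cons_cons (G : ℤ → ℤ → ℝ) (a b : ℤ) (l : List ℤ) :
    pathCost G (a :: b :: l) = G a b + pathCost G (b :: l) := rfl

theorem pathCost_append_cons (G : ℤ → ℤ → ℝ) (l₁ : List ℤ) (a : ℤ) (l₂ : List ℤ) :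
    pathCost G (l₁ ++ a :: l₂) = pathCost G (l₁ ++ [a]) + pathCost G (a :: l₂) := by
  induction l₁ with
  | nil => simp
  | cons x l ih =>
    cases l with
    | nil => simp
    | cons y l =>
      simp only [List.cons_append, pathCost_cons_cons] at ih ⊢
      rw [ih]
      ring

/-- Invariance under `t ↦ -t`, for which times are integers: each left-hand argument then yields its
right-hand twin. -/
theorem pathCost_reverse_neg (G : ℤ → ℤ → ℝ) (l : List ℤ) :
    pathCost (fun a b => G (-b) (-a)) ((l.map Neg.neg).reverse) = pathCost G l := by
  induction l with
  | nil => simp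
  | cons x l ih =>
    cases l with
    | nil => simp
    | cons y l =>
      have h : ((x :: y :: l).map Neg.neg).reverse = (l.map Neg.neg).reverse ++ (-y) :: [-x] := by
        simp
      rw [h, pathCost_append_cons]
      have h' : ((y :: l).map Neg.neg).reverse = (l.map Neg.neg).reverse ++ [-y] := by simp
      rw [← h', ih]
      simp [add_comm]

theorem pathCost_ofFn (G : ℤ → ℤ → ℝ) {k : ℕ} (f : Fin (k + 1) → ℤ) :
    pathCost G (List.ofFn f) = ∑ i : Fin k, G (f i.castSucc) (f i.succ) := by
  induction k with
  | zero => simp [List.ofFn_succ]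
  | succ k ih =>
    have h := ih fun i => f i.succ
    rw [List.ofFn_succ] at h
    rw [List.ofFn_succ, List.ofFn_succ, pathCost_cons_cons, h, Fin.sum_univ_succ]
    simp

end PathCost

/-! ### The criterion as an additive path cost, and local optimality. -/

section Criterion

/-- The sum of the entries of `v` at times before `t`. -/
noncomputable def prefixSum {n : ℕ} (v : Fin n → ℝ) (t : ℤ) : ℝ :=
  ∑ i : Fin n, if ((i : ℤ) + 1 < t) then v i else 0

theorem segmentSum_eq_prefixSum_sub {n : ℕ} (v : Fin n → ℝ) {a b : ℕ} (h : a ≤ b) :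
    segmentSum v a b = prefixSum v b - prefixSum v a := by
  rw [segmentSum, prefixSum, prefixSum, ← Finset.sum_sub_distrib]
  refine Finset.sum_congr rfl fun i _ => ?_
  by_cases h1 : ((i : ℤ) + 1 < a)
  · have h2 : ((i : ℤ) + 1 < b) := by omega
    have h3 : ¬ InSegment a b i := by rintro ⟨h3, _⟩; omega
    simp [h1, h2, h3]
  · by_cases h2 : ((i : ℤ) + 1 < b)
    · have h3 : InSegment a b i := ⟨by omega, by omega⟩
      simp [h1, h2, h3]
    · have h3 : ¬ InSegment a b i := by rintro ⟨_, h3⟩; omega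
      simp [h1, h2, h3]

namespace ChangePointVector

variable {n : ℕ}

theorem pos_castSucc_lt_succ (τ : ChangePointVector n) (k : Fin (τ.len + 1)) :
    τ.pos k.castSucc < τ.pos k.succ := τ.strictMono Fin.castSucc_lt_succ

theorem segment_unique (τ : ChangePointVector n) {k k' : Fin (τ.len + 1)} {i : Fin n}
    (h : InSegment (τ.pos k.castSucc) (τ.pos k.succ) i)
    (h' : InSegment (τ.pos k'.castSucc) (τ.pos k'.succ) i) : k = k' := by
  rcases lt_trichotomy k k' with hlt | heq | hlt
  · have : τ.pos k.succ ≤ τ.pos k'.castSucc :=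
      τ.strictMono.monotone (by rw [Fin.le_def]; simp; exact hlt)
    exact absurd (h.2.trans_le this) (not_lt.2 h'.1)
  · exact heq
  · have : τ.pos k'.succ ≤ τ.pos k.castSucc :=
      τ.strictMono.monotone (by rw [Fin.le_def]; simp; exact hlt)
    exact absurd (h'.2.trans_le this) (not_lt.2 h.1)

theorem sum_segmentSum (τ : ChangePointVector n) (v : Fin n → ℝ) :
    ∑ k : Fin (τ.len + 1), segmentSum v (τ.pos k.castSucc) (τ.pos k.succ) = ∑ i, v i := by
  have h1 : ∀ k : Fin (τ.len + 1), segmentSum v (τ.pos k.castSucc) (τ.pos k.succ) =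
      prefixSum v (τ.pos k.succ) - prefixSum v (τ.pos k.castSucc) := fun k =>
    segmentSum_eq_prefixSum_sub v (τ.pos_castSucc_lt_succ k).le
  simp_rw [h1]
  have h2 := Finset.sum_sub_distrib (s := Finset.univ)
    (fun k : Fin (τ.len + 1) => prefixSum v (τ.pos k.succ))
    (fun k : Fin (τ.len + 1) => prefixSum v (τ.pos k.castSucc))
  have h3 := Fin.sum_univ_succ fun k : Fin (τ.len + 2) => prefixSum v (τ.pos k)
  have h4 := Fin.sum_univ_castSucc fun k : Fin (τ.len + 2) => prefixSum v (τ.pos k)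
  have h5 : prefixSum v (τ.pos 0) = 0 := by
    rw [τ.pos_zero]
    refine Finset.sum_eq_zero fun i _ => if_neg (by push_cast; omega)
  have h6 : prefixSum v (τ.pos (Fin.last (τ.len + 1))) = ∑ i, v i := by
    rw [τ.pos_last]
    refine Finset.sum_congr rfl fun i _ => if_pos (by push_cast; omega)
  rw [h2]
  linarith

/-- The vector of segment means of `Y`. -/
noncomputable def segmentMean (τ : ChangePointVector n) (Y : Fin n → ℝ) (i : Fin n) : ℝ :=
  ∑ k : Fin (τ.len + 1), if InSegment (τ.pos k.castSucc) (τ.pos k.succ) i then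
    segmentSum Y (τ.pos k.castSucc) (τ.pos k.succ) /
      ((τ.pos k.succ : ℝ) - τ.pos k.castSucc) else 0

theorem sum_ite_segment (τ : ChangePointVector n) (f : Fin (τ.len + 1) → ℝ) {i : Fin n}
    {k : Fin (τ.len + 1)} (h : InSegment (τ.pos k.castSucc) (τ.pos k.succ) i) :
    (∑ k : Fin (τ.len + 1), if InSegment (τ.pos k.castSucc) (τ.pos k.succ) i then f k else 0) =
      f k := by
  rw [Finset.sum_eq_single k, if_pos h]
  · intro b _ hb
    exact if_neg fun hb' => hb (τ.segment_unique hb' h)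
  · intro h; exact absurd (Finset.mem_univ k) h

theorem segmentSum_congr {v w : Fin n → ℝ} {a b : ℕ} (h : ∀ i, InSegment a b i → v i = w i) :
    segmentSum v a b = segmentSum w a b := by
  refine Finset.sum_congr rfl fun i _ => ?_
  by_cases hi : InSegment a b i
  · simp [hi, h i hi]
  · simp [hi]

theorem segmentSum_mul_const (v : Fin n → ℝ) (c : ℝ) (a b : ℕ) :
    segmentSum (fun i => v i * c) a b = segmentSum v a b * c := by
  rw [segmentSum, segmentSum, Finset.sum_mul]
  refine Finset.sum_congr rfl fun i _ => ?_
  split_ifs <;> simp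

theorem segmentSum_sub (v w : Fin n → ℝ) (a b : ℕ) :
    segmentSum (fun i => v i - w i) a b = segmentSum v a b - segmentSum w a b := by
  rw [segmentSum, segmentSum, segmentSum, ← Finset.sum_sub_distrib]
  refine Finset.sum_congr rfl fun i _ => ?_
  split_ifs <;> simp

theorem segmentSum_const (c : ℝ) {a b : ℕ} (ha : 1 ≤ a) (hab : a ≤ b) (hb : b ≤ n + 1) :
    segmentSum (fun _ : Fin n => c) a b = c * ((b : ℝ) - a) := by
  have h : segmentSum (fun _ : Fin n => c) a b =
      ∑ i ∈ Finset.range n, if a ≤ i + 1 ∧ i + 1 < b then c else 0 := by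
    rw [← Fin.sum_univ_eq_sum_range (fun i => if a ≤ i + 1 ∧ i + 1 < b then c else 0)]
    rfl
  rw [h, ← Finset.sum_filter]
  have : (Finset.range n).filter (fun i => a ≤ i + 1 ∧ i + 1 < b) = Finset.Ico (a - 1) (b - 1) := by
    ext i
    simp
    omega
  rw [this, Finset.sum_const, Nat.card_Ico, nsmul_eq_mul]
  have : b - 1 - (a - 1) = b - a := by omega
  rw [this, Nat.cast_sub hab]
  ring

theorem one_le_pos (τ : ChangePointVector n) (k : Fin (τ.len + 2)) : 1 ≤ τ.pos k := by
  rw [← τ.pos_zero]; exact τ.strictMono.monotone (Fin.zero_le _)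

theorem pos_le (τ : ChangePointVector n) (k : Fin (τ.len + 2)) : τ.pos k ≤ n + 1 := by
  rw [← τ.pos_last]; exact τ.strictMono.monotone (Fin.le_last _)

/-- The residual from the segment means sums to zero on each segment, hence is orthogonal to every
piecewise constant vector. -/
theorem starProjection_eq (τ : ChangePointVector n) (Y : Fin n → ℝ) :
    (piecewiseConstant τ).starProjection (WithLp.toLp 2 Y) = WithLp.toLp 2 (τ.segmentMean Y) := by
  symm
  refine (Submodule.eq_starProjection_of_mem_of_inner_eq_zero ?_ ?_).symm
  · intro k i j hi hj
    change τ.segmentMean Y i = τ.segmentMean Y j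
    rw [segmentMean, segmentMean, τ.sum_ite_segment _ hi, τ.sum_ite_segment _ hj]
  · intro w hw
    have h1 : inner ℝ (WithLp.toLp 2 Y - WithLp.toLp 2 (τ.segmentMean Y)) w =
        ∑ i, (Y i - τ.segmentMean Y i) * w i := by
      rw [PiLp.inner_apply]
      refine Finset.sum_congr rfl fun i _ => ?_
      simp [mul_comm]
    rw [h1, ← τ.sum_segmentSum]
    refine Finset.sum_eq_zero fun k _ => ?_
    set a := τ.pos k.castSucc with ha
    set b := τ.pos k.succ with hb
    have hab : a < b := τ.pos_castSucc_lt_succ k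
    have hn : a - 1 < n := by
      have := τ.pos_le k.succ
      have := τ.one_le_pos k.castSucc
      omega
    have h1a : 1 ≤ a := τ.one_le_pos _
    -- Coordinate `a - 1` carries time `a`, the first time of the segment.
    have h0 : InSegment a b (⟨a - 1, hn⟩ : Fin n) := ⟨by simp; omega, by simp; omega⟩
    set M := segmentSum Y a b / ((b : ℝ) - a) with hM
    have h2 : segmentSum (fun i => (Y i - τ.segmentMean Y i) * w i) a b =
        segmentSum (fun i => (Y i - M) * w ⟨a - 1, hn⟩) a b := by
      refine segmentSum_congr fun i hi => ?_
      rw [segmentMean, τ.sum_ite_segment _ hi, hw k i ⟨a - 1, hn⟩ hi h0]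
    have hba : (b : ℝ) - a ≠ 0 := by
      have : (a : ℝ) < b := by exact_mod_cast hab
      linarith
    rw [h2, segmentSum_mul_const, segmentSum_sub,
      segmentSum_const M (τ.one_le_pos _) hab.le (τ.pos_le _), hM, div_mul_cancel₀ _ hba, sub_self,
      zero_mul]

theorem norm_sub_starProjection_sq (τ : ChangePointVector n) (Y : Fin n → ℝ) :
    ‖WithLp.toLp 2 Y - (piecewiseConstant τ).starProjection (WithLp.toLp 2 Y)‖ ^ 2 =
      ∑ i, Y i ^ 2 - ∑ k : Fin (τ.len + 1),
        segmentSum Y (τ.pos k.castSucc) (τ.pos k.succ) ^ 2 /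
          ((τ.pos k.succ : ℝ) - τ.pos k.castSucc) := by
  rw [starProjection_eq, EuclideanSpace.norm_sq_eq]
  have h1 : ∑ i, ‖(WithLp.toLp 2 Y - WithLp.toLp 2 (τ.segmentMean Y) : EuclideanSpace ℝ (Fin n)) i‖
      ^ 2 = ∑ i, (Y i - τ.segmentMean Y i) ^ 2 := by
    refine Finset.sum_congr rfl fun i _ => ?_
    simp
  rw [h1, ← τ.sum_segmentSum (fun i => (Y i - τ.segmentMean Y i) ^ 2),
    ← τ.sum_segmentSum (fun i => Y i ^ 2), ← Finset.sum_sub_distrib]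
  refine Finset.sum_congr rfl fun k _ => ?_
  set a := τ.pos k.castSucc with ha
  set b := τ.pos k.succ with hb
  have hab : a < b := τ.pos_castSucc_lt_succ k
  have hba : (b : ℝ) - a ≠ 0 := by
    have : (a : ℝ) < b := by exact_mod_cast hab
    linarith
  set M := segmentSum Y a b / ((b : ℝ) - a) with hM
  have h2 : segmentSum (fun i => (Y i - τ.segmentMean Y i) ^ 2) a b =
      segmentSum (fun i => Y i ^ 2 - (Y i * (2 * M) - M ^ 2)) a b := by
    refine segmentSum_congr fun i hi => ?_
    rw [segmentMean, τ.sum_ite_segment _ hi]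
    simp only [← ha, ← hb, ← hM]
    ring
  rw [h2, segmentSum_sub, segmentSum_sub, segmentSum_mul_const,
    segmentSum_const _ (τ.one_le_pos _) hab.le (τ.pos_le _), hM]
  field_simp
  ring

/-- The list of all positions, end points included. -/
def toList (τ : ChangePointVector n) : List ℤ := List.ofFn fun i => (τ.pos i : ℤ)

theorem pairwise_toList (τ : ChangePointVector n) : τ.toList.Pairwise (· < ·) := by
  rw [toList, List.pairwise_ofFn]
  intro i j hij
  exact_mod_cast τ.strictMono hij

theorem head?_toList (τ : ChangePointVector n) : τ.toList.head? = some 1 := by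
  rw [toList, List.ofFn_succ]
  simp [τ.pos_zero]

theorem getLast?_toList (τ : ChangePointVector n) : τ.toList.getLast? = some (n + 1 : ℤ) := by
  rw [toList, List.ofFn_succ', List.concat_eq_append, List.getLast?_append]
  simp [τ.pos_last]

/-- Turns an edited list back into an admissible competitor. The conversion `toNat` loses nothing,
since all entries are at least 1. -/
theorem exists_toList_eq {l : List ℤ} (h : l.Pairwise (· < ·)) (hh : l.head? = some 1)
    (hl : l.getLast? = some (n + 1 : ℤ)) (h2 : 2 ≤ l.length) :
    ∃ τ : ChangePointVector n, τ.toList = l := by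
  have hne : l ≠ [] := by rintro rfl; simp at h2
  have hlen : l.length - 2 + 2 = l.length := by omega
  have hget : ∀ i : Fin l.length, 1 ≤ l.get i := by
    intro i
    have h0 : l.get ⟨0, by omega⟩ = 1 := by
      rw [List.head?_eq_some_head hne, Option.some_inj] at hh
      rw [← hh, List.head_eq_getElem]; rfl
    rw [← h0]
    exact h.sortedLT.strictMono_get.monotone (by rw [Fin.le_def]; simp)
  refine ⟨⟨l.length - 2, fun i => (l.get (i.cast hlen)).toNat, ?_, ?_, ?_⟩, ?_⟩
  · intro i j hij
    have h1 : l.get (i.cast hlen) < l.get (j.cast hlen) := h.sortedLT.strictMono_get (by simpa using hij)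
    have := hget (i.cast hlen)
    have := hget (j.cast hlen)
    simp only
    omega
  · rw [List.head?_eq_some_head hne, Option.some_inj, List.head_eq_getElem] at hh
    simp [hh]
  · rw [List.getLast?_eq_some_getLast hne, Option.some_inj, List.getLast_eq_getElem] at hl
    have : (l.get ((Fin.last (l.length - 2 + 1)).cast hlen)) = (n + 1 : ℤ) := by
      rw [← hl]
      simp only [List.get_eq_getElem, Fin.val_cast, Fin.val_last]
      congr 1
      omega
    rw [this]
    omega
  · refine List.ext_get ?_ ?_
    · simp [toList]; omega
    · intro i h1 h2
      have := hget ⟨i, h2⟩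
      simp only [toList, List.get_eq_getElem, List.getElem_ofFn, Fin.val_cast] at this ⊢
      omega

end ChangePointVector

/-- The contribution of the segment `[a, b)` to the criterion. -/
noncomputable def segCost (F : ℤ → ℝ) (n L q : ℝ) (a b : ℤ) : ℝ :=
  -((F b - F a) ^ 2 / ((b : ℝ) - a)) + L * (2 * Real.log (n / ((b : ℝ) - a)) + q)

/-- `segCost` charges `q` per segment, and there is one segment more than change-points; hence the
offset `-L * q`. -/
theorem criterion_eq_pathCost {n : ℕ} (L q : ℝ) (Y : Fin n → ℝ) (τ : ChangePointVector n) :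
    criterion L q Y τ = ∑ i, Y i ^ 2 - L * q +
      pathCost (segCost (prefixSum Y) n L q) τ.toList := by
  rw [criterion, τ.norm_sub_starProjection_sq, ChangePointVector.toList, pathCost_ofFn, penalty]
  simp only [segCost, Int.cast_natCast]
  rw [Finset.sum_add_distrib, Finset.sum_neg_distrib, ← Finset.mul_sum, Finset.sum_add_distrib,
    ← Finset.mul_sum]
  have h : ∀ k : Fin (τ.len + 1), segmentSum Y (τ.pos k.castSucc) (τ.pos k.succ) =
      prefixSum Y (τ.pos k.succ) - prefixSum Y (τ.pos k.castSucc) := fun k =>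
    segmentSum_eq_prefixSum_sub Y (τ.pos_castSucc_lt_succ k).le
  simp_rw [h]
  simp
  ring

/-- No replacement of a stretch of the increasing list `l` lowers its cost. -/
structure IsLocallyOptimal (G : ℤ → ℤ → ℝ) (l : List ℤ) : Prop where
  sorted : l.Pairwise (· < ·)
  le : ∀ (l₁ : List ℤ) (a : ℤ) (s : List ℤ) (c : ℤ) (l₂ s' : List ℤ),
    l = l₁ ++ a :: (s ++ c :: l₂) → (a :: (s' ++ [c])).Pairwise (· < ·) →
      pathCost G (a :: (s ++ [c])) ≤ pathCost G (a :: (s' ++ [c]))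

theorem IsLocallyOptimal.reflect {G : ℤ → ℤ → ℝ} {l : List ℤ} (h : IsLocallyOptimal G l) :
    IsLocallyOptimal (fun a b => G (-b) (-a)) (l.map Neg.neg).reverse := by
  have hinv : ∀ l : List ℤ, ((l.map Neg.neg).reverse.map Neg.neg).reverse = l := by
    intro l; simp [List.map_reverse]
  refine ⟨?_, ?_⟩
  · rw [List.pairwise_reverse, List.pairwise_map]
    exact h.sorted.imp fun h => by simpa using h
  · intro l₁ a s c l₂ s' hl hs'
    have h1 := h.le ((l₂.map Neg.neg).reverse) (-c) ((s.map Neg.neg).reverse) (-a)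
      ((l₁.map Neg.neg).reverse) ((s'.map Neg.neg).reverse) (by
        rw [← hinv l, hl]; simp) (by
        have : (-c) :: ((s'.map Neg.neg).reverse ++ [-a]) =
          ((a :: (s' ++ [c])).map Neg.neg).reverse := by simp
        rw [this, List.pairwise_reverse, List.pairwise_map]
        exact hs'.imp fun h => by simpa using h)
    have h2 : ∀ s : List ℤ, pathCost (fun a b => G (-b) (-a)) (a :: (s ++ [c])) =
        pathCost G ((-c) :: ((s.map Neg.neg).reverse ++ [-a])) := by
      intro s
      rw [← pathCost_reverse_neg G]
      congr 1
      simp [List.map_reverse]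
    rw [h2, h2]
    exact h1

/-- The edited list is again a change-point vector, and in the comparison of criteria the costs
outside the stretch cancel. -/
theorem IsPenalizedLeastSquares.isLocallyOptimal {n : ℕ} {L q : ℝ} {Y : Fin n → ℝ}
    {τ : ChangePointVector n} (h : IsPenalizedLeastSquares L q Y τ) :
    IsLocallyOptimal (segCost (prefixSum Y) n L q) τ.toList := by
  refine ⟨τ.pairwise_toList, ?_⟩
  intro l₁ a s c l₂ s' hl hs'
  have hsort := τ.pairwise_toList
  have hhead := τ.head?_toList
  have hlast := τ.getLast?_toList
  rw [hl] at hsort hhead hlast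
  obtain ⟨τ', hτ'⟩ := ChangePointVector.exists_toList_eq (n := n)
    (l := l₁ ++ a :: (s' ++ c :: l₂)) (by
      simp only [List.pairwise_append, List.pairwise_cons, List.mem_cons, List.mem_append,
        List.not_mem_nil, or_false] at hsort hs' ⊢
      obtain ⟨h1, ⟨h2, h3, ⟨h4, h5⟩, h6⟩, h7⟩ := hsort
      obtain ⟨h8, h9, -, h10⟩ := hs'
      have hac := h8 c (Or.inr rfl)
      refine ⟨h1, ⟨?_, h9, ⟨h4, h5⟩, ?_⟩, ?_⟩
      · rintro x (hx | rfl | hx)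
        · exact h8 x (Or.inl hx)
        · exact hac
        · exact hac.trans (h4 x hx)
      · rintro x hx y (rfl | hy)
        · exact h10 x hx _ rfl
        · exact (h10 x hx _ rfl).trans (h4 y hy)
      · rintro x hx y (rfl | hy | rfl | hy)
        · exact h7 x hx _ (Or.inl rfl)
        · exact (h7 x hx a (Or.inl rfl)).trans (h8 y (Or.inl hy))
        · exact (h7 x hx a (Or.inl rfl)).trans hac
        · exact h7 x hx _ (Or.inr (Or.inr (Or.inr hy)))) (by
      rw [← hhead]; cases l₁ <;> simp) (by
      rw [← hlast]; simp [List.getLast?_append, List.getLast?_cons]) (by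
      simp; omega)
  have h1 := h τ'
  rw [criterion_eq_pathCost, criterion_eq_pathCost, hτ', hl, pathCost_append_cons _ l₁ a,
    pathCost_append_cons _ l₁ a (s' ++ _)] at h1
  rw [← List.cons_append, ← List.cons_append, pathCost_append_cons _ (a :: s),
    pathCost_append_cons _ (a :: s')] at h1
  simp only [List.cons_append] at h1
  linarith

end Criterion

/-! ### Cost of splitting a segment. -/

section Triads

/-- `ψ_q²` at the triad `(a, b, c)`. -/
noncomputable def triadPenalty (n q : ℝ) (a b c : ℤ) : ℝ :=
  2 * Real.log (n * ((c : ℝ) - a) / (((c : ℝ) - b) * ((b : ℝ) - a))) + q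

/-- The squared CUSUM statistic of the increments of `F`. -/
noncomputable def cusumSq (F : ℤ → ℝ) (a b c : ℤ) : ℝ :=
  ((F c - F b) / ((c : ℝ) - b) - (F b - F a) / ((b : ℝ) - a)) ^ 2 *
    (((b : ℝ) - a) * ((c : ℝ) - b) / ((c : ℝ) - a))

theorem log_triad_eq {n u v : ℝ} (hn : 0 < n) (hu : 0 < u) (hv : 0 < v) :
    Real.log (n * (u + v) / (v * u)) =
      Real.log (n / u) + Real.log (n / v) - Real.log (n / (u + v)) := by
  rw [Real.log_div (by positivity) (by positivity), Real.log_mul (by positivity) (by positivity),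
    Real.log_mul (by positivity) (by positivity), Real.log_div (by positivity) (by positivity),
    Real.log_div (by positivity) (by positivity), Real.log_div (by positivity) (by positivity)]
  ring

/-- The identity behind every comparison below: the fit terms combine by the between-groups variance
formula, the logarithms by `log_triad_eq`. -/
theorem segCost_split {F : ℤ → ℝ} {n L q : ℝ} (hn : 0 < n) {a b c : ℤ} (hab : a < b)
    (hbc : b < c) :
    segCost F n L q a b + segCost F n L q b c - segCost F n L q a c =
      L * triadPenalty n q a b c - cusumSq F a b c := by
  have h1 : (0 : ℝ) < (b : ℝ) - a := by
    have : (a : ℝ) < b := by exact_mod_cast hab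
    linarith
  have h2 : (0 : ℝ) < (c : ℝ) - b := by
    have : (b : ℝ) < c := by exact_mod_cast hbc
    linarith
  have h3 : (c : ℝ) - a = (b - a) + (c - b) := by ring
  have h4 : F c - F a = (F b - F a) + (F c - F b) := by ring
  unfold segCost triadPenalty cusumSq
  rw [h3, h4, log_triad_eq hn h1 h2]
  generalize (b : ℝ) - a = u at *
  generalize (c : ℝ) - b = v at *
  generalize F b - F a = x
  generalize F c - F b = y
  have : x ^ 2 / u + y ^ 2 / v - (x + y) ^ 2 / (u + v) = (y / v - x / u) ^ 2 * (u * v / (u + v)) := by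
    field_simp
    ring
  linear_combination -this

theorem cusumSq_nonneg (F : ℤ → ℝ) {a b c : ℤ} (hab : a < b) (hbc : b < c) :
    0 ≤ cusumSq F a b c := by
  have h1 : (a : ℝ) < b := by exact_mod_cast hab
  have h2 : (b : ℝ) < c := by exact_mod_cast hbc
  exact mul_nonneg (sq_nonneg _) (div_nonneg (mul_nonneg (by linarith) (by linarith)) (by linarith))

theorem le_triadPenalty_right {n q : ℝ} (hn : 0 < n) {a b c : ℤ} (hab : a < b) (hbc : b < c) :
    2 * Real.log (n / ((c : ℝ) - b)) + q ≤ triadPenalty n q a b c := by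
  have h1 : (a : ℝ) < b := by exact_mod_cast hab
  have h2 : (b : ℝ) < c := by exact_mod_cast hbc
  have h3 : (0 : ℝ) < (c : ℝ) - b := by linarith
  have h4 : (0 : ℝ) < (b : ℝ) - a := by linarith
  have : Real.log (n / ((c : ℝ) - b)) ≤
      Real.log (n * ((c : ℝ) - a) / (((c : ℝ) - b) * ((b : ℝ) - a))) := by
    refine Real.log_le_log (by positivity) ?_
    rw [div_le_div_iff₀ h3 (by positivity)]
    nlinarith [mul_pos hn h3, mul_pos (mul_pos hn h3) h3]
  unfold triadPenalty
  linarith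

theorem le_triadPenalty_left {n q : ℝ} (hn : 0 < n) {a b c : ℤ} (hab : a < b) (hbc : b < c) :
    2 * Real.log (n / ((b : ℝ) - a)) + q ≤ triadPenalty n q a b c := by
  have h1 : (a : ℝ) < b := by exact_mod_cast hab
  have h2 : (b : ℝ) < c := by exact_mod_cast hbc
  have h3 : (0 : ℝ) < (c : ℝ) - b := by linarith
  have h4 : (0 : ℝ) < (b : ℝ) - a := by linarith
  have : Real.log (n / ((b : ℝ) - a)) ≤
      Real.log (n * ((c : ℝ) - a) / (((c : ℝ) - b) * ((b : ℝ) - a))) := by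
    refine Real.log_le_log (by positivity) ?_
    rw [div_le_div_iff₀ h4 (by positivity)]
    nlinarith [mul_pos hn h4, mul_pos (mul_pos hn h4) h4]
  unfold triadPenalty
  linarith

theorem triadPenalty_le {n q R : ℝ} (hn : 0 < n) (hR : 0 < R) {a b c : ℤ}
    (hab : R ≤ (b : ℝ) - a) (hbc : R ≤ (c : ℝ) - b) :
    triadPenalty n q a b c ≤ 2 * Real.log (2 * n / R) + q := by
  have h3 : (0 : ℝ) < (c : ℝ) - b := by linarith
  have h4 : (0 : ℝ) < (b : ℝ) - a := by linarith
  have h5 : (0 : ℝ) < (c : ℝ) - a := by linarith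
  have : Real.log (n * ((c : ℝ) - a) / (((c : ℝ) - b) * ((b : ℝ) - a))) ≤
      Real.log (2 * n / R) := by
    refine Real.log_le_log (by positivity) ?_
    rw [div_le_div_iff₀ (by positivity) hR]
    nlinarith [mul_le_mul_of_nonneg_left hab (mul_pos hn h3).le,
      mul_le_mul_of_nonneg_left hbc (mul_pos hn h4).le]
  unfold triadPenalty
  linarith

/-- If splitting off a stretch of length `v` is not worth its penalty, the mean over the union is
close to the mean over the other stretch, however small `v` is. -/
theorem sq_mean_sub_le {n L q u v x y : ℝ} (hn : 0 < n) (hL : 0 ≤ L) (hu : 0 < u) (hv : 0 < v)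
    (hq : 0 ≤ 2 * Real.log (n / u) + q)
    (h : (y / u - x / v) ^ 2 * (v * u / (v + u)) ≤ L * (2 * Real.log (n * (v + u) / (u * v)) + q)) :
    ((x + y) / (v + u) - y / u) ^ 2 ≤ L * (2 * Real.log (n / u) + q + 2) / u := by
  -- The factor `v / (u (v + u))` absorbs the penalty's `log ((v + u) / v)`, which blows up for
  -- small `v`: by `log z ≤ z` their product is bounded.
  have h1 : ((x + y) / (v + u) - y / u) ^ 2 =
      (y / u - x / v) ^ 2 * (v * u / (v + u)) * (v / (u * (v + u))) := by
    field_simp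
    ring
  have h2 : Real.log (n * (v + u) / (u * v)) = Real.log (n / u) + Real.log ((v + u) / v) := by
    rw [← Real.log_mul (by positivity) (by positivity)]
    congr 1
    field_simp
  have h3 : Real.log ((v + u) / v) ≤ (v + u) / v := by
    have := Real.log_le_sub_one_of_pos (show 0 < (v + u) / v by positivity)
    linarith
  rw [h1]
  have h4 : (y / u - x / v) ^ 2 * (v * u / (v + u)) ≤
      L * (2 * Real.log (n / u) + q + 2 * ((v + u) / v)) := by
    refine h.trans (mul_le_mul_of_nonneg_left ?_ hL)
    rw [h2]; linarith
  calc _ ≤ L * (2 * Real.log (n / u) + q + 2 * ((v + u) / v)) * (v / (u * (v + u))) :=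
        mul_le_mul_of_nonneg_right h4 (by positivity)
    _ = L * ((2 * Real.log (n / u) + q) * (v / (v + u)) + 2) / u := by
        field_simp
    _ ≤ L * ((2 * Real.log (n / u) + q) * 1 + 2) / u := by
        gcongr
        rw [div_le_one (by positivity)]
        linarith
    _ = _ := by ring

end Triads

/-! ### Neighbours in a sorted list. -/

section Lists

theorem exists_eq_append_cons_cons {l : List ℤ} (hs : l.Pairwise (· < ·)) {T : ℤ} (hT : T ∉ l)
    (h1 : ∃ x ∈ l, x < T) (h2 : ∃ y ∈ l, T < y) :
    ∃ l₁ b c l₂, l = l₁ ++ b :: c :: l₂ ∧ b < T ∧ T < c := by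
  induction l with
  | nil => simp at h1
  | cons z l ih =>
    have hz : z < T := by
      obtain ⟨x, hx, hxT⟩ := h1
      rcases List.mem_cons.1 hx with rfl | hx
      · exact hxT
      · exact ((List.pairwise_cons.1 hs).1 x hx).trans hxT
    obtain ⟨y, hy, hyT⟩ := h2
    have hy : y ∈ l := by
      rcases List.mem_cons.1 hy with rfl | hy
      · exact absurd hz (not_lt.2 hyT.le)
      · exact hy
    cases l with
    | nil => simp at hy
    | cons w l =>
      rcases lt_trichotomy w T with hw | rfl | hw
      · obtain ⟨l₁, b, c, l₂, h, hb, hc⟩ := ih (List.pairwise_cons.1 hs).2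
          (fun h => hT (List.mem_cons_of_mem _ h)) ⟨w, by simp, hw⟩ ⟨y, hy, hyT⟩
        exact ⟨z :: l₁, b, c, l₂, by rw [h]; rfl, hb, hc⟩
      · simp at hT
      · exact ⟨[], z, w, l, rfl, hz, hw⟩

theorem exists_eq_append_singleton {l₁ l₂ : List ℤ} {b x : ℤ}
    (hs : (l₁ ++ b :: l₂).Pairwise (· < ·)) (hx : x ∈ l₁ ++ b :: l₂) (hxb : x < b) :
    ∃ l₀ a, l₁ = l₀ ++ [a] ∧ a < b := by
  rw [List.pairwise_append] at hs
  obtain ⟨_, h2, h3⟩ := hs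
  have hx1 : x ∈ l₁ := by
    rcases List.mem_append.1 hx with h | h
    · exact h
    · rcases List.mem_cons.1 h with rfl | h
      · exact absurd hxb (lt_irrefl _)
      · exact absurd ((List.pairwise_cons.1 h2).1 x h) (not_lt.2 hxb.le)
  rcases List.eq_nil_or_concat l₁ with rfl | ⟨l₀, a, rfl⟩
  · simp at hx1
  · exact ⟨l₀, a, by simp, h3 a (by simp) b (by simp)⟩

end Lists

/-! ### The deterministic configuration to be refuted, and its reflection. -/

/-- A locally optimal segmentation `l` none of whose interior entries is at distance less than `d`
of the change-point `T`. The increments of `F` have mean `μ₁` on `[s, T)` and `μ₂` on `[T, t)`; `W`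
is the noise. -/
structure MissedChangePoint (n L q e δ K m d μ₁ μ₂ : ℝ) (F W : ℤ → ℝ) (s T t : ℤ) (l : List ℤ) :
    Prop where
  one_lt_L : 1 < L
  lt_q : 3 < q
  sq_lt : e ^ 2 < L
  delta_pos : 0 < δ
  delta_le : δ ≤ 1 / 16
  le_log_delta : L ≤ (L - e ^ 2) * Real.log (1 / δ)
  le_K : 16000 * L ≤ K
  le_K_mul : 32 * L * (1 + 2 * Real.log (2 / δ)) ≤ K * δ
  lt_left : s < T
  lt_right : T < t
  sub_le_n : (t : ℝ) - s ≤ n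
  one_le_m : 1 ≤ m
  m_le_left : m ≤ (T : ℝ) - s
  m_le_right : m ≤ (t : ℝ) - T
  energy_ge : K * (2 * Real.log (n / m) + q) ≤ (μ₂ - μ₁) ^ 2 * m
  optimal : IsLocallyOptimal (segCost F n L q) l
  exists_le : ∃ x ∈ l, x ≤ s
  exists_ge : ∃ x ∈ l, t ≤ x
  eq_left : ∀ a, s ≤ a → a ≤ T → F T - F a = μ₁ * ((T : ℝ) - a) + (W T - W a)
  eq_right : ∀ a, T ≤ a → a ≤ t → F a - F T = μ₂ * ((a : ℝ) - T) + (W a - W T)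
  cusumSq_le : ∀ a b c, s ≤ a → a < b → b < c → c ≤ t →
    cusumSq W a b c ≤ e ^ 2 * triadPenalty n q a b c
  abs_left_le : ∀ a, s ≤ a → d ≤ (T : ℝ) - a →
    |W T - W a| ≤ 1 / 40 * |μ₂ - μ₁| * ((T : ℝ) - a)
  abs_right_le : ∀ a, a ≤ t → d ≤ (a : ℝ) - T →
    |W a - W T| ≤ 1 / 40 * |μ₂ - μ₁| * ((a : ℝ) - T)
  d_pos : 0 < d
  le_dist : ∀ p ∈ l, s < p → p < t → d ≤ |(p : ℝ) - T|

theorem segCost_reflect (F : ℤ → ℝ) (n L q : ℝ) :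
    (fun a b => segCost F n L q (-b) (-a)) = segCost (fun x => -F (-x)) n L q := by
  funext a b
  simp only [segCost]
  push_cast
  rw [show -(a : ℝ) - -b = b - a by ring]
  ring_nf

namespace MissedChangePoint

variable {n L q e δ K m d μ₁ μ₂ : ℝ} {F W : ℤ → ℝ} {s T t : ℤ} {l : List ℤ}

theorem reflect (h : MissedChangePoint n L q e δ K m d μ₁ μ₂ F W s T t l) :
    MissedChangePoint n L q e δ K m d μ₂ μ₁ (fun x => -F (-x)) (fun x => -W (-x)) (-t) (-T) (-s)
      (l.map Neg.neg).reverse where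
  one_lt_L := h.one_lt_L
  lt_q := h.lt_q
  sq_lt := h.sq_lt
  delta_pos := h.delta_pos
  delta_le := h.delta_le
  le_log_delta := h.le_log_delta
  le_K := h.le_K
  le_K_mul := h.le_K_mul
  lt_left := neg_lt_neg h.lt_right
  lt_right := neg_lt_neg h.lt_left
  sub_le_n := by push_cast; linarith [h.sub_le_n]
  one_le_m := h.one_le_m
  m_le_left := by push_cast; linarith [h.m_le_right]
  m_le_right := by push_cast; linarith [h.m_le_left]
  energy_ge := by
    have := h.energy_ge
    rw [show (μ₁ - μ₂) ^ 2 = (μ₂ - μ₁) ^ 2 by ring]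
    exact this
  optimal := by
    rw [← segCost_reflect]
    exact h.optimal.reflect
  exists_le := by
    obtain ⟨x, hx, hxt⟩ := h.exists_ge
    exact ⟨-x, by simpa using hx, by omega⟩
  exists_ge := by
    obtain ⟨x, hx, hxt⟩ := h.exists_le
    exact ⟨-x, by simpa using hx, by omega⟩
  eq_left := by
    intro a ha haT
    have := h.eq_right (-a) (by omega) (by omega)
    simp only [neg_neg]
    push_cast at this ⊢
    linear_combination this
  eq_right := by
    intro a ha haT
    have := h.eq_left (-a) (by omega) (by omega)
    simp only [neg_neg]
    push_cast at this ⊢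
    linear_combination this
  cusumSq_le := by
    intro a b c h1 h2 h3 h4
    have h5 := h.cusumSq_le (-c) (-b) (-a) (by omega) (by omega) (by omega) (by omega)
    have h6 : cusumSq (fun x => -W (-x)) a b c = cusumSq W (-c) (-b) (-a) := by
      simp only [cusumSq]
      push_cast
      ring_nf
    have h7 : triadPenalty n q a b c = triadPenalty n q (-c) (-b) (-a) := by
      simp only [triadPenalty]
      push_cast
      ring_nf
    rw [h6, h7]
    exact h5
  abs_left_le := by
    intro a h1 h2
    push_cast at h2
    have := h.abs_right_le (-a) (by omega) (by push_cast; linarith)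
    simp only [neg_neg]
    push_cast at this ⊢
    rw [abs_sub_comm μ₁, show -W T - -W (-a) = W (-a) - W T by ring,
      show -(T : ℝ) - a = -a - T by ring]
    exact this
  abs_right_le := by
    intro a h1 h2
    push_cast at h2
    have := h.abs_left_le (-a) (by omega) (by push_cast; linarith)
    simp only [neg_neg]
    push_cast at this ⊢
    rw [abs_sub_comm μ₁, show -W (-a) - -W T = W T - W (-a) by ring,
      show (a : ℝ) - -T = T - -a by ring]
    exact this
  d_pos := h.d_pos
  le_dist := by
    intro p hp h1 h2
    have := h.le_dist (-p) (by simpa [neg_eq_iff_eq_neg] using hp) (by omega) (by omega)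
    push_cast at this ⊢
    rw [show (p : ℝ) - -T = -(-p - T) by ring, abs_neg]
    exact this

end MissedChangePoint

theorem log_div_nonneg_of_le {n u : ℝ} (hu : 0 < u) (hun : u ≤ n) : 0 ≤ Real.log (n / u) :=
  Real.log_nonneg ((one_le_div hu).2 hun)

/-! ### Means over fitted segments, and removal of entries near `T`. -/

namespace MissedChangePoint

variable {n L q e δ K m d μ₁ μ₂ : ℝ} {F W : ℤ → ℝ} {s T t : ℤ} {l : List ℤ}

theorem n_pos (h : MissedChangePoint n L q e δ K m d μ₁ μ₂ F W s T t l) : 0 < n := by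
  have := h.sub_le_n
  have := h.one_le_m
  have := h.m_le_left
  have := h.m_le_right
  linarith

theorem m_le_n (h : MissedChangePoint n L q e δ K m d μ₁ μ₂ F W s T t l) : m ≤ n := by
  have := h.sub_le_n
  have := h.one_le_m
  have := h.m_le_left
  have := h.m_le_right
  linarith

theorem sorted_split (h : MissedChangePoint n L q e δ K m d μ₁ μ₂ F W s T t l) {l₁ l₂ : List ℤ}
    {a b : ℤ} (hl : l = l₁ ++ a :: b :: l₂) : a < b := by
  have := h.optimal.sorted
  rw [hl] at this
  have := (List.pairwise_append.1 this).2.1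
  exact (List.pairwise_cons.1 this).1 b (by simp)

theorem insert_le (h : MissedChangePoint n L q e δ K m d μ₁ μ₂ F W s T t l) {l₁ l₂ : List ℤ}
    {a x b : ℤ} (hl : l = l₁ ++ a :: b :: l₂) (hax : a < x) (hxb : x < b) :
    cusumSq F a x b ≤ L * triadPenalty n q a x b := by
  have h1 := h.optimal.le l₁ a [] b l₂ [x] (by simpa using hl) (by simp; omega)
  simp only [List.nil_append, List.cons_append, pathCost_cons_cons, pathCost_singleton] at h1
  have h2 := segCost_split (F := F) (L := L) (q := q) h.n_pos hax hxb
  linarith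

/-- Long suffixes of a fitted segment have about the same mean as the whole segment. -/
theorem abs_mean_sub_mean_le (h : MissedChangePoint n L q e δ K m d μ₁ μ₂ F W s T t l)
    {l₁ l₂ : List ℤ} {a x b : ℤ} (hl : l = l₁ ++ a :: b :: l₂) (hax : a < x) (hxb : x < b)
    (hm : m / 2 ≤ (b : ℝ) - x) (hn : (b : ℝ) - x ≤ n) :
    |(F b - F a) / ((b : ℝ) - a) - (F b - F x) / ((b : ℝ) - x)| ≤ 1 / 40 * |μ₂ - μ₁| := by
  have h0 := h.n_pos
  have hL := h.one_lt_L
  have hq := h.lt_q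
  have h1m := h.one_le_m
  have hu : (0 : ℝ) < (b : ℝ) - x := by linarith
  have hv : (0 : ℝ) < (x : ℝ) - a := by
    have : (a : ℝ) < x := by exact_mod_cast hax
    linarith
  have h1 := h.insert_le hl hax hxb
  unfold cusumSq triadPenalty at h1
  rw [show (b : ℝ) - a = (x - a) + (b - x) by ring] at h1 ⊢
  rw [show F b - F a = (F x - F a) + (F b - F x) by ring]
  have h2 := sq_mean_sub_le (n := n) (q := q) (x := F x - F a) (y := F b - F x) h0
    (by linarith) hu hv (by have := log_div_nonneg_of_le hu hn; linarith) h1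
  set u := (b : ℝ) - x with hu'
  have h3 : Real.log (n / u) ≤ Real.log (n / m) + 1 := by
    have h4 : Real.log (n / u) ≤ Real.log (2 * (n / m)) := by
      refine Real.log_le_log (by positivity) ?_
      rw [← mul_div_assoc, div_le_div_iff₀ hu (by linarith)]
      nlinarith
    rw [Real.log_mul (by norm_num) (by positivity)] at h4
    have := Real.log_two_lt_d9
    linarith
  have h5 := log_div_nonneg_of_le (n := n) (u := m) (by linarith) h.m_le_n
  have h6 := h.energy_ge
  have h7 := h.le_K
  -- With `A = 2 log (n / m) + q > 3`, the left numerator is at most `4 L A`, while `Δ² u / 1600 ≥ K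
  -- A / 3200 ≥ 5 L A`; this is the use of the constant 16000.
  have h8 : L * (2 * Real.log (n / u) + q + 2) / u ≤ (1 / 40 * |μ₂ - μ₁|) ^ 2 := by
    rw [mul_pow, sq_abs, div_le_iff₀ hu]
    have h9 : L * (2 * Real.log (n / u) + q + 2) ≤ L * (4 * (2 * Real.log (n / m) + q)) := by
      apply mul_le_mul_of_nonneg_left _ (by linarith)
      linarith
    have h10 : 16000 * L * (2 * Real.log (n / m) + q) ≤ K * (2 * Real.log (n / m) + q) :=
      mul_le_mul_of_nonneg_right h7 (by linarith)
    have h11 : (μ₂ - μ₁) ^ 2 * (m / 2) ≤ (μ₂ - μ₁) ^ 2 * u :=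
      mul_le_mul_of_nonneg_left hm (sq_nonneg _)
    have h12 : 0 ≤ L * (2 * Real.log (n / m) + q) := mul_nonneg (by linarith) (by linarith)
    linarith
  exact abs_le_of_sq_le_sq (h2.trans h8) (by positivity)

theorem abs_mean_left_le (h : MissedChangePoint n L q e δ K m d μ₁ μ₂ F W s T t l) {b : ℤ}
    (hb : s ≤ b) (hd : d ≤ (T : ℝ) - b) :
    |(F T - F b) / ((T : ℝ) - b) - μ₁| ≤ 1 / 40 * |μ₂ - μ₁| := by
  have hu : (0 : ℝ) < (T : ℝ) - b := by linarith [h.d_pos]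
  have hbT : b ≤ T := by
    have : (b : ℝ) < T := by linarith
    exact_mod_cast this.le
  rw [h.eq_left b hb hbT, add_div, mul_div_assoc, div_self hu.ne', mul_one, add_sub_cancel_left,
    abs_div, abs_of_pos hu, div_le_iff₀ hu]
  exact h.abs_left_le b hb hd

theorem abs_mean_right_le (h : MissedChangePoint n L q e δ K m d μ₁ μ₂ F W s T t l) {c : ℤ}
    (hc : c ≤ t) (hd : d ≤ (c : ℝ) - T) :
    |(F c - F T) / ((c : ℝ) - T) - μ₂| ≤ 1 / 40 * |μ₂ - μ₁| := by
  have hu : (0 : ℝ) < (c : ℝ) - T := by linarith [h.d_pos]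
  have hcT : T ≤ c := by
    have : (T : ℝ) < c := by linarith
    exact_mod_cast this.le
  rw [h.eq_right c hcT hc, add_div, mul_div_assoc, div_self hu.ne', mul_one, add_sub_cancel_left,
    abs_div, abs_of_pos hu, div_le_iff₀ hu]
  exact h.abs_right_le c hc hd

/-- The noise on `[a, b)` is the difference of the noises on `[a, T)` and `[b, T)`, both controlled,
of total length at most `3 (b - a)`. -/
theorem abs_mean_inner_le (h : MissedChangePoint n L q e δ K m d μ₁ μ₂ F W s T t l) {a b : ℤ}
    (ha : s ≤ a) (hab : a < b) (hbT : b < T) (hd : d ≤ (T : ℝ) - b)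
    (hlen : (T : ℝ) - b ≤ (b : ℝ) - a) :
    |(F b - F a) / ((b : ℝ) - a) - μ₁| ≤ 3 / 40 * |μ₂ - μ₁| := by
  have h1 : (a : ℝ) < b := by exact_mod_cast hab
  have hu : (0 : ℝ) < (b : ℝ) - a := by linarith
  have h2 := h.eq_left a ha (by omega)
  have h3 := h.eq_left b (by omega) hbT.le
  have h4 := h.abs_left_le a ha (by linarith)
  have h5 := h.abs_left_le b (by omega) hd
  rw [show F b - F a = μ₁ * ((b : ℝ) - a) + ((W T - W a) - (W T - W b)) by linear_combination h2 - h3,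
    add_div, mul_div_assoc, div_self hu.ne', mul_one, add_sub_cancel_left,
    abs_div, abs_of_pos hu, div_le_iff₀ hu]
  refine (abs_sub _ _).trans ?_
  nlinarith [abs_nonneg (μ₂ - μ₁)]

/-- The means on both sides of `b` are close to `μ₁`, so the CUSUM lost by removing `b` is small. If
the fitted segment starts before `s`, where nothing is known of the signal, `abs_mean_sub_mean_le`
transfers its mean to `[s, b)`. -/
theorem cost_remove_regular (h : MissedChangePoint n L q e δ K m d μ₁ μ₂ F W s T t l)
    {l₁ l₂ : List ℤ} {a b : ℤ} (hl : l = l₁ ++ a :: b :: l₂) (hsb : s < b) (hbT : b < T)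
    (hd : d ≤ (T : ℝ) - b)
    (hcase : (a < s ∧ m / 2 ≤ (b : ℝ) - s ∧ (T : ℝ) - b ≤ (b : ℝ) - s) ∨
      (s ≤ a ∧ (T : ℝ) - b ≤ (b : ℝ) - a)) :
    L * (2 * Real.log (n / ((T : ℝ) - b)) + q) - (μ₂ - μ₁) ^ 2 * ((T : ℝ) - b) / 64 ≤
      segCost F n L q a b + segCost F n L q b T - segCost F n L q a T := by
  have hab := h.sorted_split hl
  have h0 := h.n_pos
  have hL := h.one_lt_L
  rw [segCost_split h0 hab hbT]
  have h1 := le_triadPenalty_right (q := q) h0 hab hbT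
  have h2 := mul_le_mul_of_nonneg_left h1 (show (0 : ℝ) ≤ L by linarith)
  have hab' : (a : ℝ) < b := by exact_mod_cast hab
  have hbT' : (b : ℝ) < T := by exact_mod_cast hbT
  have hsb' : (s : ℝ) < b := by exact_mod_cast hsb
  have h3 : |(F b - F a) / ((b : ℝ) - a) - μ₁| ≤ 4 / 40 * |μ₂ - μ₁| := by
    rcases hcase with ⟨h4, h5, h6⟩ | ⟨h4, h5⟩
    · have htT : (T : ℝ) < t := by exact_mod_cast h.lt_right
      have h7 := h.abs_mean_sub_mean_le hl h4 hsb h5 (by linarith [h.sub_le_n])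
      have h8 := h.abs_mean_inner_le le_rfl hsb hbT hd h6
      have h9 := abs_sub_le ((F b - F a) / ((b : ℝ) - a)) ((F b - F s) / ((b : ℝ) - s)) μ₁
      linarith
    · have h8 := h.abs_mean_inner_le h4 hab hbT hd h5
      linarith [abs_nonneg (μ₂ - μ₁)]
  have h4 := h.abs_mean_left_le hsb.le hd
  have h5 : |(F T - F b) / ((T : ℝ) - b) - (F b - F a) / ((b : ℝ) - a)| ≤ 5 / 40 * |μ₂ - μ₁| := by
    have := abs_sub_le ((F T - F b) / ((T : ℝ) - b)) μ₁ ((F b - F a) / ((b : ℝ) - a))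
    rw [abs_sub_comm μ₁] at this
    linarith
  have h6 : cusumSq F a b T ≤ (μ₂ - μ₁) ^ 2 * ((T : ℝ) - b) / 64 := by
    unfold cusumSq
    have h7 : ((F T - F b) / ((T : ℝ) - b) - (F b - F a) / ((b : ℝ) - a)) ^ 2 ≤
        (μ₂ - μ₁) ^ 2 / 64 := by
      rw [← sq_abs, ← sq_abs (μ₂ - μ₁)]
      nlinarith [abs_nonneg ((F T - F b) / ((T : ℝ) - b) - (F b - F a) / ((b : ℝ) - a)),
        abs_nonneg (μ₂ - μ₁)]
    have h8 : ((b : ℝ) - a) * ((T : ℝ) - b) / ((T : ℝ) - a) ≤ (T : ℝ) - b := by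
      rw [div_le_iff₀ (by linarith)]
      nlinarith
    calc _ ≤ (μ₂ - μ₁) ^ 2 / 64 * ((T : ℝ) - b) :=
          mul_le_mul h7 h8 (div_nonneg (mul_nonneg (by linarith) (by linarith)) (by linarith))
            (by positivity)
      _ = _ := by ring
  linarith

/-- Left of `T` the signal is constant, so the CUSUM sees only noise. -/
theorem cusumSq_le_left (h : MissedChangePoint n L q e δ K m d μ₁ μ₂ F W s T t l) {a b c : ℤ}
    (hsa : s ≤ a) (hab : a < b) (hbc : b < c) (hcT : c ≤ T) :
    cusumSq F a b c ≤ e ^ 2 * triadPenalty n q a b c := by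
  have h3 := h.cusumSq_le a b c hsa hab hbc (by have := h.lt_right; omega)
  have ea := h.eq_left a hsa (by omega)
  have eb := h.eq_left b (by omega) (by omega)
  have ec := h.eq_left c (by omega) hcT
  have hab' : (a : ℝ) < b := by exact_mod_cast hab
  have hbc' : (b : ℝ) < c := by exact_mod_cast hbc
  have u1 : ((c : ℝ) - b) ≠ 0 := by linarith
  have u2 : ((b : ℝ) - a) ≠ 0 := by linarith
  refine le_trans (le_of_eq ?_) h3
  unfold cusumSq
  rw [show F c - F b = μ₁ * ((c : ℝ) - b) + (W c - W b) by linear_combination eb - ec,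
    show F b - F a = μ₁ * ((b : ℝ) - a) + (W b - W a) by linear_combination ea - eb,
    add_div, add_div, mul_div_assoc, mul_div_assoc, div_self u1, div_self u2]
  ring

/-- On the good event no fitted change-point lies in the interior of a constant stretch of the
signal together with both of its fitted neighbours. -/
theorem lt_of_consecutive (h : MissedChangePoint n L q e δ K m d μ₁ μ₂ F W s T t l)
    {l₁ l₂ : List ℤ} {a b c : ℤ} (hl : l = l₁ ++ a :: b :: c :: l₂) (hcT : c ≤ T) : a < s := by
  by_contra! hsa
  have hab := h.sorted_split hl
  have hbc := h.sorted_split (l₁ := l₁ ++ [a]) (by simpa using hl)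
  have h0 := h.n_pos
  have h1 := h.optimal.le l₁ a [b] c l₂ [] (by simpa using hl) (by simp; omega)
  simp only [List.nil_append, List.cons_append, pathCost_cons_cons, pathCost_singleton] at h1
  have h2 := segCost_split (F := F) (L := L) (q := q) h0 hab hbc
  have hT := h.lt_right
  have h3 := h.cusumSq_le_left hsa hab hbc hcT
  have h5 : 0 < triadPenalty n q a b c := by
    have h6 := le_triadPenalty_right (q := q) h0 hab hbc
    have h7 : (s : ℝ) ≤ b := by exact_mod_cast (by omega : s ≤ b)
    have h8 : (c : ℝ) ≤ t := by exact_mod_cast (by omega : c ≤ t)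
    have h9 : (b : ℝ) < c := by exact_mod_cast hbc
    have := log_div_nonneg_of_le (n := n) (u := (c : ℝ) - b) (by linarith) (by linarith [h.sub_le_n])
    linarith [h.lt_q]
  have := mul_lt_mul_of_pos_right h.sq_lt h5
  linarith

/-- The fitted change-points on the left of `T` and close to `T` can be removed with a gain of
almost one penalty term, provided `T` is made a change-point. -/
theorem exists_removal_left (h : MissedChangePoint n L q e δ K m d μ₁ μ₂ F W s T t l)
    {l₀ l₂ : List ℤ} {b : ℤ} (hl : l = l₀ ++ b :: l₂) (hbT : b < T)
    (hbm : (T : ℝ) - b ≤ δ * m) :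
    ∃ l₁ a r, l₀ ++ [b] = l₁ ++ a :: (r ++ [b]) ∧ a < T ∧
      L * (2 * Real.log (n / ((T : ℝ) - b)) + q) - (μ₂ - μ₁) ^ 2 * ((T : ℝ) - b) / 32 ≤
        pathCost (segCost F n L q) (a :: (r ++ [b])) + segCost F n L q b T -
          segCost F n L q a T := by
  have h0 := h.n_pos
  have hL := h.one_lt_L
  have hq := h.lt_q
  have hm1 := h.one_le_m
  have hml := h.m_le_left
  have hbm16 : (T : ℝ) - b ≤ m / 16 := by
    have := mul_le_mul_of_nonneg_right h.delta_le (show 0 ≤ m by linarith)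
    linarith
  have hsT' : (s : ℝ) < T := by exact_mod_cast h.lt_left
  have htT' : (T : ℝ) < t := by exact_mod_cast h.lt_right
  have hbT' : (b : ℝ) < T := by exact_mod_cast hbT
  have hsb : s < b := by
    have : (s : ℝ) < b := by linarith
    exact_mod_cast this
  have hbd : d ≤ (T : ℝ) - b := by
    have := h.le_dist b (by rw [hl]; simp) hsb (by have := h.lt_right; omega)
    rwa [abs_sub_comm, abs_of_pos (by linarith)] at this
  obtain ⟨x, hx, hxs⟩ := h.exists_le
  obtain ⟨l₀', a, rfl, hab⟩ := exists_eq_append_singleton (l₁ := l₀) (l₂ := l₂) (b := b) (x := x)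
    (by rw [← hl]; exact h.optimal.sorted) (by rw [← hl]; exact hx) (by omega)
  have hab' : (a : ℝ) < b := by exact_mod_cast hab
  have hD : 0 ≤ (μ₂ - μ₁) ^ 2 * ((T : ℝ) - b) := mul_nonneg (sq_nonneg _) (by linarith)
  by_cases hreg : a < s ∨ (T : ℝ) - b ≤ (b : ℝ) - a
  · refine ⟨l₀', a, [], by simp, by omega, ?_⟩
    have := h.cost_remove_regular (l₁ := l₀') (l₂ := l₂) (a := a) (b := b) (by simpa using hl)
      hsb hbT hbd (by
        by_cases has : a < s
        · exact Or.inl ⟨has, by linarith, by linarith⟩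
        · exact Or.inr ⟨not_lt.1 has, by tauto⟩)
    simp only [List.nil_append, pathCost_cons_cons, pathCost_singleton]
    linarith
  -- Here `[a, b)` may be shorter than `d`, so its mean is not controlled; `a` is removed together
  -- with `b`. The entry before `a` lies left of `s`, so removing `a` is a regular case.
  · push Not at hreg
    obtain ⟨hsa, hlen⟩ := hreg
    have hsa' : s < a := by
      have : (s : ℝ) < a := by linarith
      exact_mod_cast this
    obtain ⟨l₁, a', rfl, ha'a⟩ := exists_eq_append_singleton (l₁ := l₀') (l₂ := b :: l₂) (b := a)
      (x := x) (by have := h.optimal.sorted; rw [hl] at this; simpa using this)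
      (by rw [hl] at hx; simpa using hx) (by omega)
    have ha's : a' < s := h.lt_of_consecutive (l₁ := l₁) (l₂ := l₂) (a := a') (b := a) (c := b)
      (by simpa using hl) hbT.le
    refine ⟨l₁, a', [a], by simp, by omega, ?_⟩
    have h1 := h.cost_remove_regular (l₁ := l₁) (l₂ := b :: l₂) (a := a') (b := a)
      (by simpa using hl) hsa' (by omega) (by linarith)
      (Or.inl ⟨ha's, by linarith, by linarith⟩)
    have h2 := segCost_split (F := F) (L := L) (q := q) h0 hab hbT
    have h3 := h.cusumSq_le_left hsa hab hbT le_rfl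
    have h4 := le_triadPenalty_right (q := q) h0 hab hbT
    -- Removing `b` first gains `(L - e²) ψ² ≥ 2 L` by the choice of `δ`. This pays for having `T -
    -- a ≤ 2 (T - b)` instead of `T - b` in the penalty.
    have h5 : Real.log (1 / δ) ≤ Real.log (n / ((T : ℝ) - b)) := by
      have hδ := h.delta_pos
      refine Real.log_le_log (by positivity) ?_
      rw [div_le_div_iff₀ hδ (by linarith)]
      have := mul_le_mul_of_nonneg_left h.m_le_n hδ.le
      linarith
    have h6 : (L - e ^ 2) * (2 * Real.log (1 / δ)) ≤ (L - e ^ 2) * triadPenalty n q a b T :=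
      mul_le_mul_of_nonneg_left (by linarith) (by linarith [h.sq_lt])
    have h7 := h.le_log_delta
    have h8 : Real.log (n / ((T : ℝ) - b)) ≤ Real.log (n / ((T : ℝ) - a)) + 1 := by
      have hTa : (0 : ℝ) < (T : ℝ) - a := by linarith
      have hTb : (0 : ℝ) < (T : ℝ) - b := by linarith
      have h9 : Real.log (n / ((T : ℝ) - b)) ≤ Real.log (2 * (n / ((T : ℝ) - a))) := by
        refine Real.log_le_log (by positivity) ?_
        rw [← mul_div_assoc, div_le_div_iff₀ hTb hTa]
        nlinarith
      rw [Real.log_mul (by norm_num) (by positivity)] at h9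
      have := Real.log_two_lt_d9
      linarith
    have h10 : L * (2 * Real.log (n / ((T : ℝ) - b)) + q) ≤
        L * (2 * Real.log (n / ((T : ℝ) - a)) + q + 2) :=
      mul_le_mul_of_nonneg_left (by linarith) (by linarith)
    have h11 : (μ₂ - μ₁) ^ 2 * ((T : ℝ) - a) ≤ (μ₂ - μ₁) ^ 2 * (2 * ((T : ℝ) - b)) :=
      mul_le_mul_of_nonneg_left (by linarith) (sq_nonneg _)
    simp only [List.nil_append, List.cons_append, pathCost_cons_cons, pathCost_singleton]
    linarith

theorem exists_removal_right (h : MissedChangePoint n L q e δ K m d μ₁ μ₂ F W s T t l)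
    {l₀ l₂ : List ℤ} {c : ℤ} (hl : l = l₂ ++ c :: l₀) (hTc : T < c)
    (hcm : (c : ℝ) - T ≤ δ * m) :
    ∃ l₁ a r, c :: l₀ = c :: (r ++ a :: l₁) ∧ T < a ∧
      L * (2 * Real.log (n / ((c : ℝ) - T)) + q) - (μ₂ - μ₁) ^ 2 * ((c : ℝ) - T) / 32 ≤
        pathCost (segCost F n L q) (c :: (r ++ [a])) + segCost F n L q T c -
          segCost F n L q T a := by
  obtain ⟨l₁, a, r, h1, h2, h3⟩ := h.reflect.exists_removal_left
    (l₀ := (l₀.map Neg.neg).reverse) (l₂ := (l₂.map Neg.neg).reverse) (b := -c)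
    (by rw [hl]; simp) (by omega) (by push_cast; linarith)
  refine ⟨(l₁.map Neg.neg).reverse, -a, (r.map Neg.neg).reverse, ?_, by omega, ?_⟩
  · have := congrArg (fun l => (l.map Neg.neg).reverse) h1
    simpa [List.map_reverse] using this
  · rw [← segCost_reflect] at h3
    have h4 : pathCost (fun a b => segCost F n L q (-b) (-a)) (a :: (r ++ [-c])) =
        pathCost (segCost F n L q) (c :: ((r.map Neg.neg).reverse ++ [-a])) := by
      rw [← pathCost_reverse_neg (segCost F n L q)]
      congr 1
      simp [List.map_reverse]
    rw [h4] at h3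
    simp only [neg_neg] at h3
    push_cast at h3
    rw [show -(T : ℝ) - -(c : ℝ) = c - T by ring, show (μ₁ - μ₂) ^ 2 = (μ₂ - μ₁) ^ 2 by ring] at h3
    exact h3

end MissedChangePoint

/-! ### Localization near `T` and the final contradiction. -/

namespace MissedChangePoint

variable {n L q e δ K m d μ₁ μ₂ : ℝ} {F W : ℤ → ℝ} {s T t : ℤ} {l : List ℤ}

theorem log_two_div_delta_nonneg (h : MissedChangePoint n L q e δ K m d μ₁ μ₂ F W s T t l) :
    0 ≤ Real.log (2 / δ) := by
  have h1 := h.delta_pos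
  have h2 := h.delta_le
  exact Real.log_nonneg ((one_le_div h1).2 (by linarith))

theorem not_mem (h : MissedChangePoint n L q e δ K m d μ₁ μ₂ F W s T t l) : T ∉ l := by
  intro hT
  have h1 := h.le_dist T hT h.lt_left h.lt_right
  rw [sub_self, abs_zero] at h1
  linarith [h.d_pos]

theorem split_le (h : MissedChangePoint n L q e δ K m d μ₁ μ₂ F W s T t l) {R : ℝ} (hR : 0 < R)
    {a b c : ℤ} (hab : R ≤ (b : ℝ) - a) (hbc : R ≤ (c : ℝ) - b) :
    segCost F n L q a b + segCost F n L q b c ≤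
      segCost F n L q a c + L * (2 * Real.log (2 * n / R) + q) := by
  have h1 : a < b := by
    have : (a : ℝ) < b := by linarith
    exact_mod_cast this
  have h2 : b < c := by
    have : (b : ℝ) < c := by linarith
    exact_mod_cast this
  have h3 := segCost_split (F := F) (L := L) (q := q) h.n_pos h1 h2
  have h4 := cusumSq_nonneg F h1 h2
  have h5 := mul_le_mul_of_nonneg_left (triadPenalty_le (q := q) h.n_pos hR hab hbc)
    (show 0 ≤ L by linarith [h.one_lt_L])
  linarith

/-- A fitted segment around `T` cannot extend far on both sides of `T`. -/
theorem cusumSq_le_of_spanning (h : MissedChangePoint n L q e δ K m d μ₁ μ₂ F W s T t l)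
    {l₁ l₂ : List ℤ} {a x y c : ℤ} (hl : l = l₁ ++ a :: c :: l₂) {R : ℝ} (hR : 0 < R) (hRn : R ≤ n)
    (hx : x = a ∨ R ≤ (x : ℝ) - a) (hxT : R ≤ (T : ℝ) - x) (hTy : R ≤ (y : ℝ) - T)
    (hy : y = c ∨ R ≤ (c : ℝ) - y) :
    cusumSq F x T y ≤ 3 * (L * (2 * Real.log (2 * n / R) + q)) := by
  have h0 := h.n_pos
  have hL := h.one_lt_L
  have h1 : x < T := by
    have : (x : ℝ) < T := by linarith
    exact_mod_cast this
  have h2 : T < y := by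
    have : (T : ℝ) < y := by linarith
    exact_mod_cast this
  have h3 := segCost_split (F := F) (L := L) (q := q) h0 h1 h2
  have h4 := mul_le_mul_of_nonneg_left (triadPenalty_le (q := q) h0 hR hxT hTy)
    (show 0 ≤ L by linarith)
  have key : ∀ s' : List ℤ, (a :: (s' ++ [c])).Pairwise (· < ·) →
      segCost F n L q a c ≤ pathCost (segCost F n L q) (a :: (s' ++ [c])) := fun s' hs' => by
    have := h.optimal.le l₁ a [] c l₂ s' (by simpa using hl) hs'
    simpa using this
  have h7 : 0 ≤ L * (2 * Real.log (2 * n / R) + q) := by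
    have := log_div_nonneg_of_le (n := 2 * n) hR (by linarith)
    exact mul_nonneg (by linarith) (by linarith [h.lt_q])
  -- Inserting `T` and whichever of `x`, `y` are new costs at most one penalty per point, hence at
  -- most three.
  rcases hx with rfl | hx <;> rcases hy with rfl | hy
  · have := key [T] (by simp; omega)
    simp only [List.nil_append, List.cons_append, pathCost_cons_cons, pathCost_singleton] at this
    linarith
  · have hyc : y < c := by
      have : (y : ℝ) < c := by linarith
      exact_mod_cast this
    have h5 := key [T, y] (by simp; omega)
    simp only [List.nil_append, List.cons_append, pathCost_cons_cons, pathCost_singleton] at h5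
    have h9 := h.split_le hR (a := x) (b := y) (c := c) (by linarith) hy
    linarith
  · have hax : a < x := by
      have : (a : ℝ) < x := by linarith
      exact_mod_cast this
    have h5 := key [x, T] (by simp; omega)
    simp only [List.nil_append, List.cons_append, pathCost_cons_cons, pathCost_singleton] at h5
    have h8 := h.split_le hR (a := a) (b := x) (c := y) hx (by linarith)
    linarith
  · have hyc : y < c := by
      have : (y : ℝ) < c := by linarith
      exact_mod_cast this
    have hax : a < x := by
      have : (a : ℝ) < x := by linarith
      exact_mod_cast this
    have h5 := key [x, T, y] (by simp; omega)
    simp only [List.nil_append, List.cons_append, pathCost_cons_cons, pathCost_singleton] at h5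
    have h8 := h.split_le hR (a := a) (b := x) (c := c) hx (by linarith)
    have h9 := h.split_le hR (a := x) (b := y) (c := c) (by linarith) hy
    linarith

/-- Otherwise one fitted segment covers `T` with room `δ m` on each side; its CUSUM at `T` is at
most three penalties by optimality, but at least of order `Δ² δ m` by high energy. -/
theorem exists_near (h : MissedChangePoint n L q e δ K m d μ₁ μ₂ F W s T t l) :
    ∃ p ∈ l, |(p : ℝ) - T| < δ * m := by
  by_contra! hfar
  have hL := h.one_lt_L
  have hm1 := h.one_le_m
  have hδ := h.delta_pos
  have hδ16 := h.delta_le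
  have hsT := h.lt_left
  have hTt := h.lt_right
  have hml := h.m_le_left
  have hmr := h.m_le_right
  have h0 := h.n_pos
  obtain ⟨x₀, hx₀, hx₀s⟩ := h.exists_le
  obtain ⟨y₀, hy₀, hy₀t⟩ := h.exists_ge
  obtain ⟨l₁, a, c, l₂, hl, haT, hTc⟩ := exists_eq_append_cons_cons h.optimal.sorted h.not_mem
    ⟨x₀, hx₀, by omega⟩ ⟨y₀, hy₀, by omega⟩
  have haT' : (a : ℝ) < T := by exact_mod_cast haT
  have hTc' : (T : ℝ) < c := by exact_mod_cast hTc
  have hfa := hfar a (by rw [hl]; simp)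
  have hfc := hfar c (by rw [hl]; simp)
  rw [abs_sub_comm, abs_of_pos (by linarith)] at hfa
  rw [abs_of_pos (by linarith)] at hfc
  have hδm : 0 < δ * m := by positivity
  obtain ⟨R, hR⟩ : ∃ R : ℤ, R = ⌈δ * m⌉ := ⟨_, rfl⟩
  have hR1 : 1 ≤ R := by rw [hR]; exact Int.one_le_ceil_iff.2 hδm
  have hRle : δ * m ≤ R := by rw [hR]; exact Int.le_ceil _
  have hRlt : (R : ℝ) < δ * m + 1 := by rw [hR]; exact Int.ceil_lt_add_one _
  have hRa : R ≤ T - a := by rw [hR, Int.ceil_le]; push_cast; exact hfa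
  have hRc : R ≤ c - T := by rw [hR, Int.ceil_le]; push_cast; exact hfc
  have hR0 : (0 : ℝ) < R := by linarith
  have h2R : 2 * (R : ℝ) - 1 ≤ m := by
    by_cases h1 : δ * m ≤ 1
    · have : R ≤ 1 := by rw [hR, Int.ceil_le]; exact_mod_cast h1
      have : (R : ℝ) ≤ 1 := by exact_mod_cast this
      linarith
    · have : δ * m ≤ 1 / 16 * m := mul_le_mul_of_nonneg_right hδ16 (by linarith)
      linarith
  have h2Rs : 2 * R - 1 ≤ T - s := by
    have : ((2 * R - 1 : ℤ) : ℝ) ≤ ((T - s : ℤ) : ℝ) := by push_cast; linarith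
    exact_mod_cast this
  have h2Rt : 2 * R - 1 ≤ t - T := by
    have : ((2 * R - 1 : ℤ) : ℝ) ≤ ((t - T : ℤ) : ℝ) := by push_cast; linarith
    exact_mod_cast this
  -- Insert `T - R` only if both pieces keep length `R`; otherwise keep `a`, which satisfies `a ≥ T
  -- - 2 R + 1 ≥ s`.
  obtain ⟨x, hsx, hxT, hxa⟩ : ∃ x, s ≤ x ∧ R ≤ T - x ∧ (x = a ∨ R ≤ x - a) := by
    by_cases h1 : T - a < 2 * R
    · exact ⟨a, by omega, hRa, Or.inl rfl⟩
    · exact ⟨T - R, by omega, by omega, Or.inr (by omega)⟩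
  obtain ⟨y, hyt, hTy, hyc⟩ : ∃ y, y ≤ t ∧ R ≤ y - T ∧ (y = c ∨ R ≤ c - y) := by
    by_cases h1 : c - T < 2 * R
    · exact ⟨c, by omega, hRc, Or.inl rfl⟩
    · exact ⟨T + R, by omega, by omega, Or.inr (by omega)⟩
  have hcast : ∀ u v : ℤ, R ≤ u - v → (R : ℝ) ≤ (u : ℝ) - v := fun u v huv => by
    exact_mod_cast huv
  have hRn : (R : ℝ) ≤ n := by
    have := h.m_le_n
    linarith
  have h1 := h.cusumSq_le_of_spanning hl hR0 hRn (hxa.imp_right (hcast x a)) (hcast T x hxT)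
    (hcast y T hTy) (hyc.imp_right (hcast c y))
  have h2 := h.cusumSq_le x T y hsx (by omega) (by omega) hyt
  have h3 := triadPenalty_le (q := q) h0 hR0 (hcast T x hxT) (hcast y T hTy)
  set Ψ := 2 * Real.log (2 * n / R) + q with hΨ
  have hΨ0 : 0 ≤ Ψ := by
    have := log_div_nonneg_of_le (n := 2 * n) hR0 (by linarith)
    linarith [h.lt_q]
  have h4 : cusumSq W x T y ≤ L * Ψ := by
    refine h2.trans ((mul_le_mul_of_nonneg_left h3 (sq_nonneg e)).trans ?_)
    exact mul_le_mul_of_nonneg_right h.sq_lt.le hΨ0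
  have hu := hcast T x hxT
  have hv := hcast y T hTy
  have hF1 := h.eq_left x hsx (by omega)
  have hF2 := h.eq_right y (by omega) hyt
  -- The jump is the observed difference of means minus that of the noise; `8 = 2 * 3 + 2 * 1`.
  have h5 : (μ₂ - μ₁) ^ 2 * (R / 2) ≤ 8 * (L * Ψ) := by
    unfold cusumSq at h1 h4
    rw [hF1, hF2] at h1
    rw [show (y : ℝ) - x = (T - x) + (y - T) by ring] at h1 h4
    generalize (T : ℝ) - x = u at *
    generalize (y : ℝ) - T = v at *
    rw [add_div, add_div, mul_div_assoc, mul_div_assoc, div_self (by linarith),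
      div_self (by linarith), mul_one, mul_one] at h1
    generalize (W y - W T) / v = ω₂ at *
    generalize (W T - W x) / u = ω₁ at *
    have hH : (R : ℝ) / 2 ≤ u * v / (u + v) := by
      rw [div_le_div_iff₀ (by norm_num) (by linarith)]
      nlinarith
    generalize u * v / (u + v) = H at *
    have hH0 : 0 ≤ H := by linarith
    have h6 : (μ₂ - μ₁) ^ 2 ≤ 2 * (μ₂ + ω₂ - (μ₁ + ω₁)) ^ 2 + 2 * (ω₂ - ω₁) ^ 2 := by
      nlinarith [sq_nonneg (μ₂ - μ₁ + 2 * (ω₂ - ω₁))]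
    have h7 := mul_le_mul_of_nonneg_right h6 hH0
    have h8 := mul_le_mul_of_nonneg_left hH (sq_nonneg (μ₂ - μ₁))
    linarith
  set A := 2 * Real.log (n / m) + q with hA
  have hA3 : 3 < A := by
    have := log_div_nonneg_of_le (n := n) (u := m) (by linarith) h.m_le_n
    linarith [h.lt_q]
  have hg := h.log_two_div_delta_nonneg
  have h6 : Ψ ≤ A + 2 * Real.log (2 / δ) := by
    have : Real.log (2 * n / R) ≤ Real.log (n / m) + Real.log (2 / δ) := by
      rw [← Real.log_mul (by positivity) (by positivity)]
      refine Real.log_le_log (by positivity) ?_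
      rw [div_mul_div_comm, mul_comm m, mul_comm n]
      exact div_le_div_of_nonneg_left (by positivity) hδm hRle
    linarith
  have h7 : 32 * L * (1 + 2 * Real.log (2 / δ)) * A ≤ K * δ * A :=
    mul_le_mul_of_nonneg_right h.le_K_mul (by linarith)
  have h8 : δ * (K * A) ≤ δ * ((μ₂ - μ₁) ^ 2 * m) := mul_le_mul_of_nonneg_left h.energy_ge hδ.le
  have h9 : (μ₂ - μ₁) ^ 2 * (δ * m) ≤ (μ₂ - μ₁) ^ 2 * R :=
    mul_le_mul_of_nonneg_left hRle (sq_nonneg _)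
  have h10 : L * Ψ ≤ L * ((1 + 2 * Real.log (2 / δ)) * A) := by
    refine mul_le_mul_of_nonneg_left ?_ (by linarith)
    nlinarith
  have h11 : 0 < L * ((1 + 2 * Real.log (2 / δ)) * A) := by positivity
  linarith

theorem cusumSq_ge (h : MissedChangePoint n L q e δ K m d μ₁ μ₂ F W s T t l)
    {l₁ l₂ : List ℤ} {b c : ℤ} (hl : l = l₁ ++ b :: c :: l₂) (hbT : b < T) (hTc : T < c)
    (hle : (c : ℝ) - T ≤ (T : ℝ) - b) (hcm : (c : ℝ) - T ≤ δ * m) :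
    (μ₂ - μ₁) ^ 2 * ((c : ℝ) - T) / 5 ≤ cusumSq F b T c := by
  have hbT' : (b : ℝ) < T := by exact_mod_cast hbT
  have hTc' : (T : ℝ) < c := by exact_mod_cast hTc
  have hm1 := h.one_le_m
  have hml := h.m_le_left
  have hmr := h.m_le_right
  have hcm16 : (c : ℝ) - T ≤ m / 16 := by
    have := mul_le_mul_of_nonneg_right h.delta_le (show 0 ≤ m by linarith)
    linarith
  have hct : c < t := by
    have : (c : ℝ) < t := by linarith
    exact_mod_cast this
  have hd : d ≤ (c : ℝ) - T := by
    have := h.le_dist c (by rw [hl]; simp) (by have := h.lt_left; omega) hct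
    rwa [abs_of_pos (by linarith)] at this
  have h2 := h.abs_mean_right_le hct.le hd
  by_cases hsb : s ≤ b
  · have h1 := h.abs_mean_left_le hsb (hd.trans hle)
    unfold cusumSq
    rw [show (c : ℝ) - b = (T - b) + (c - T) by ring]
    generalize (F c - F T) / ((c : ℝ) - T) = M₂ at *
    generalize (F T - F b) / ((T : ℝ) - b) = M₁ at *
    have hu : 0 < (T : ℝ) - b := by linarith
    have hv : 0 < (c : ℝ) - T := by linarith
    generalize (T : ℝ) - b = u at *
    generalize (c : ℝ) - T = v at *
    have hH : v / 2 ≤ u * v / (u + v) := by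
      rw [div_le_div_iff₀ (by norm_num) (by linarith)]
      nlinarith
    have h3 : (μ₂ - μ₁) ^ 2 * (2 / 5) ≤ (M₂ - M₁) ^ 2 := by
      have h4 : |μ₂ - μ₁| ≤ |M₂ - M₁| + |M₂ - μ₂| + |M₁ - μ₁| := by
        rw [show μ₂ - μ₁ = (M₂ - M₁) - (M₂ - μ₂) + (M₁ - μ₁) by ring]
        exact (abs_add_le _ _).trans (add_le_add (abs_sub _ _) le_rfl)
      rw [← sq_abs, ← sq_abs (M₂ - M₁)]
      nlinarith [abs_nonneg (μ₂ - μ₁), abs_nonneg (M₂ - M₁)]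
    calc (μ₂ - μ₁) ^ 2 * v / 5 = (μ₂ - μ₁) ^ 2 * (2 / 5) * (v / 2) := by ring
      _ ≤ _ := mul_le_mul h3 hH (by positivity) (sq_nonneg _)
  -- For `b < s` the mean over `[b, T)` is unknown. The CUSUM is rewritten with the mean over `[b,
  -- c)`, which optimality ties to the mean over `[s, c)`.
  · push Not at hsb
    have hsT' : (s : ℝ) < T := by exact_mod_cast h.lt_left
    have hct' : (c : ℝ) < t := by exact_mod_cast hct
    have h1 := h.abs_mean_left_le le_rfl (show d ≤ (T : ℝ) - s by linarith)
    have h3 := h.abs_mean_sub_mean_le hl hsb (by have := h.lt_left; omega) (by linarith)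
      (by linarith [h.sub_le_n])
    have hid1 : cusumSq F b T c = ((F c - F T) / ((c : ℝ) - T) - (F c - F b) / ((c : ℝ) - b)) ^ 2 *
        (((c : ℝ) - T) * ((c : ℝ) - b) / ((T : ℝ) - b)) := by
      have u1 : (T : ℝ) - b ≠ 0 := by linarith
      have u2 : (c : ℝ) - T ≠ 0 := by linarith
      have u3 : (c : ℝ) - b ≠ 0 := by linarith
      unfold cusumSq
      field_simp
      ring
    have hid2 : (F c - F T) / ((c : ℝ) - T) - (F c - F s) / ((c : ℝ) - s) =
        ((F c - F T) / ((c : ℝ) - T) - (F T - F s) / ((T : ℝ) - s)) *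
          (((T : ℝ) - s) / ((c : ℝ) - s)) := by
      have u1 : (T : ℝ) - s ≠ 0 := by linarith
      have u2 : (c : ℝ) - T ≠ 0 := by linarith
      have u3 : (c : ℝ) - s ≠ 0 := by linarith
      field_simp
      ring
    have hratio : 16 / 17 ≤ ((T : ℝ) - s) / ((c : ℝ) - s) := by
      rw [div_le_div_iff₀ (by norm_num) (by linarith)]
      linarith
    have hH : (c : ℝ) - T ≤ ((c : ℝ) - T) * ((c : ℝ) - b) / ((T : ℝ) - b) := by
      rw [le_div_iff₀ (by linarith)]
      nlinarith
    rw [hid1]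
    generalize (F c - F T) / ((c : ℝ) - T) = M₂ at *
    generalize (F T - F s) / ((T : ℝ) - s) = M₁ at *
    generalize (F c - F b) / ((c : ℝ) - b) = M at *
    generalize (F c - F s) / ((c : ℝ) - s) = M' at *
    generalize ((T : ℝ) - s) / ((c : ℝ) - s) = r at *
    have h4 : |μ₂ - μ₁| ≤ |M₂ - M₁| + |M₂ - μ₂| + |M₁ - μ₁| := by
      rw [show μ₂ - μ₁ = (M₂ - M₁) - (M₂ - μ₂) + (M₁ - μ₁) by ring]
      exact (abs_add_le _ _).trans (add_le_add (abs_sub _ _) le_rfl)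
    have h5 : |M₂ - M'| = |M₂ - M₁| * r := by
      rw [hid2, abs_mul, abs_of_nonneg (show 0 ≤ r by linarith)]
    have h6 : |M₂ - M'| ≤ |M₂ - M| + |M - M'| := abs_sub_le _ _ _
    have h7 : |M₂ - M₁| * (16 / 17) ≤ |M₂ - M₁| * r :=
      mul_le_mul_of_nonneg_left hratio (abs_nonneg _)
    have h8 : |μ₂ - μ₁| * (4 / 5) ≤ |M₂ - M| := by
      linarith [abs_nonneg (μ₂ - μ₁)]
    have h9 : (μ₂ - μ₁) ^ 2 * (1 / 5) ≤ (M₂ - M) ^ 2 := by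
      rw [← sq_abs, ← sq_abs (M₂ - M)]
      nlinarith [abs_nonneg (μ₂ - μ₁), abs_nonneg (M₂ - M)]
    calc (μ₂ - μ₁) ^ 2 * ((c : ℝ) - T) / 5 = (μ₂ - μ₁) ^ 2 * (1 / 5) * ((c : ℝ) - T) := by ring
      _ ≤ _ := mul_le_mul h9 hH (by linarith) (sq_nonneg _)

/-- Makes entries within `16 L / Δ²` of `T` eligible for the removal lemmas. -/
theorem sixteen_mul_le (h : MissedChangePoint n L q e δ K m d μ₁ μ₂ F W s T t l) :
    16 * L ≤ (μ₂ - μ₁) ^ 2 * (δ * m) := by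
  have hL := h.one_lt_L
  have hm1 := h.one_le_m
  have hδ := h.delta_pos
  have hA3 : 3 < 2 * Real.log (n / m) + q := by
    have := log_div_nonneg_of_le (n := n) (u := m) (by linarith) h.m_le_n
    linarith [h.lt_q]
  have hg := h.log_two_div_delta_nonneg
  have h7 := h.le_K_mul
  have h8 := mul_le_mul_of_nonneg_left h.energy_ge hδ.le
  have h9 : 32 * L * 1 ≤ 32 * L * (1 + 2 * Real.log (2 / δ)) :=
    mul_le_mul_of_nonneg_left (by linarith) (by linarith)
  have h10 : K * δ * 1 ≤ K * δ * (2 * Real.log (n / m) + q) :=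
    mul_le_mul_of_nonneg_left (by linarith) (by linarith)
  linarith

/-- When both neighbours are very close to `T`, it pays to replace them by `T`. -/
theorem false_of_bracket (h : MissedChangePoint n L q e δ K m d μ₁ μ₂ F W s T t l)
    {l₁ l₂ : List ℤ} {b c : ℤ} (hl : l = l₁ ++ b :: c :: l₂) (hbT : b < T) (hTc : T < c)
    (hb : (μ₂ - μ₁) ^ 2 * ((T : ℝ) - b) < 16 * L) (hc : (μ₂ - μ₁) ^ 2 * ((c : ℝ) - T) < 16 * L) :
    False := by
  have h0 := h.n_pos
  have hL := h.one_lt_L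
  have h16 := h.sixteen_mul_le
  have hbT' : (b : ℝ) < T := by exact_mod_cast hbT
  have hTc' : (T : ℝ) < c := by exact_mod_cast hTc
  have hbm : (T : ℝ) - b ≤ δ * m := (lt_of_mul_lt_mul_left (hb.trans_le h16) (sq_nonneg _)).le
  have hcm : (c : ℝ) - T ≤ δ * m := (lt_of_mul_lt_mul_left (hc.trans_le h16) (sq_nonneg _)).le
  obtain ⟨p₁, a, r, h1, haT, h2⟩ := h.exists_removal_left (l₂ := c :: l₂) hl hbT hbm
  obtain ⟨p₂, a', r', h3, hTa', h4⟩ := h.exists_removal_right (l₂ := l₁ ++ [b]) (l₀ := l₂)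
    (by simpa using hl) hTc hcm
  have hl' : l = p₁ ++ a :: ((r ++ b :: c :: r') ++ a' :: p₂) := by
    rw [hl, h3, ← List.singleton_append (x := b), ← List.append_assoc, h1]
    simp
  have h5 := h.optimal.le p₁ a _ a' p₂ [T] hl' (by simp; omega)
  have h6 : pathCost (segCost F n L q) (a :: ((r ++ b :: c :: r') ++ [a'])) =
      pathCost (segCost F n L q) (a :: (r ++ [b])) + (segCost F n L q b c +
        pathCost (segCost F n L q) (c :: (r' ++ [a']))) := by
    have := pathCost_append_cons (segCost F n L q) (a :: r) b (c :: (r' ++ [a']))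
    simpa using this
  rw [h6] at h5
  simp only [List.nil_append, List.cons_append, pathCost_cons_cons, pathCost_singleton] at h5
  have h7 := segCost_split (F := F) (L := L) (q := q) h0 hbT hTc
  have h8 := cusumSq_nonneg F hbT hTc
  have hu : 0 < (T : ℝ) - b := by linarith
  have hv : 0 < (c : ℝ) - T := by linarith
  have hm16 : δ * m ≤ m := by
    have := mul_le_mul_of_nonneg_right h.delta_le (show 0 ≤ m by linarith [h.one_le_m])
    linarith [h.one_le_m]
  have h9 : triadPenalty n q b T c ≤ 2 * Real.log (n / ((T : ℝ) - b)) +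
      2 * Real.log (n / ((c : ℝ) - T)) + 2 * Real.log 2 + q := by
    unfold triadPenalty
    rw [show (c : ℝ) - b = (T - b) + (c - T) by ring, log_triad_eq h0 hu hv]
    have : -Real.log (n / ((T - b) + (c - T) : ℝ)) ≤ Real.log 2 := by
      rw [← Real.log_inv]
      refine Real.log_le_log (by positivity) ?_
      rw [inv_div, div_le_iff₀ h0]
      linarith [h.m_le_n]
    linarith
  have h10 := mul_le_mul_of_nonneg_left h9 (show 0 ≤ L by linarith)
  have h11 := Real.log_two_lt_d9
  have h12 : L * 3 < L * q := mul_lt_mul_of_pos_left h.lt_q (by linarith)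
  have h13 : L * (2 * Real.log 2) ≤ L * 2 := mul_le_mul_of_nonneg_left (by linarith) (by linarith)
  -- Two penalties are saved for one: the surplus `L q > 3 L` exceeds `2 L log 2` plus two removal
  -- errors of at most `L / 2`.
  linarith

/-- When `b` is far, `T - b ≥ 16 L / Δ²` makes the penalty of the triad `(b, T, c)` nearly that of
`c` alone, so moving `c` to `T` is almost free and gains the CUSUM. -/
theorem false_of_right_closer (h : MissedChangePoint n L q e δ K m d μ₁ μ₂ F W s T t l)
    {l₁ l₂ : List ℤ} {b c : ℤ} (hl : l = l₁ ++ b :: c :: l₂) (hbT : b < T) (hTc : T < c)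
    (hle : (c : ℝ) - T ≤ (T : ℝ) - b) : False := by
  have h0 := h.n_pos
  have hL := h.one_lt_L
  have hbT' : (b : ℝ) < T := by exact_mod_cast hbT
  have hTc' : (T : ℝ) < c := by exact_mod_cast hTc
  by_cases hb : (μ₂ - μ₁) ^ 2 * ((T : ℝ) - b) < 16 * L
  · exact h.false_of_bracket hl hbT hTc hb
      ((mul_le_mul_of_nonneg_left hle (sq_nonneg _)).trans_lt hb)
  push Not at hb
  -- No entry is closer to `T` than `c`, so `c` inherits the bound on `p`.
  obtain ⟨p, hp, hpm⟩ := h.exists_near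
  have hcm : (c : ℝ) - T ≤ δ * m := by
    refine le_trans ?_ hpm.le
    have hs := h.optimal.sorted
    rw [hl] at hp hs
    rw [List.pairwise_append] at hs
    obtain ⟨_, hs2, hs3⟩ := hs
    rw [List.mem_append, List.mem_cons, List.mem_cons] at hp
    simp only [List.pairwise_cons] at hs2
    rcases hp with hp | rfl | rfl | hp
    · have : (p : ℝ) < b := by exact_mod_cast hs3 p hp b (by simp)
      rw [abs_of_neg (by linarith)]
      linarith
    · rw [abs_of_neg (by linarith)]
      linarith
    · exact le_abs_self _
    · have : (c : ℝ) < p := by exact_mod_cast hs2.2.1 p hp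
      rw [abs_of_pos (by linarith)]
      linarith
  obtain ⟨p₂, a', r', h3, hTa', h4⟩ := h.exists_removal_right (l₂ := l₁ ++ [b]) (l₀ := l₂)
    (by simpa using hl) hTc hcm
  have hl' : l = l₁ ++ b :: ((c :: r') ++ a' :: p₂) := by
    rw [hl, h3]
    simp
  have h5 := h.optimal.le l₁ b _ a' p₂ [T] hl' (by simp; omega)
  simp only [List.nil_append, List.cons_append, pathCost_cons_cons, pathCost_singleton] at h5
  have h7 := segCost_split (F := F) (L := L) (q := q) h0 hbT hTc
  have h8 := h.cusumSq_ge hl hbT hTc hle hcm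
  have hu : 0 < (T : ℝ) - b := by linarith
  have hv : 0 < (c : ℝ) - T := by linarith
  have h9 : triadPenalty n q b T c ≤ 2 * Real.log (n / ((c : ℝ) - T)) + q +
      2 * (((c : ℝ) - T) / ((T : ℝ) - b)) := by
    unfold triadPenalty
    have : Real.log (n * ((c : ℝ) - b) / (((c : ℝ) - T) * ((T : ℝ) - b))) ≤
        Real.log (n / ((c : ℝ) - T)) + ((c : ℝ) - T) / ((T : ℝ) - b) := by
      have h10 : n * ((c : ℝ) - b) / (((c : ℝ) - T) * ((T : ℝ) - b)) =
          n / ((c : ℝ) - T) * (1 + ((c : ℝ) - T) / ((T : ℝ) - b)) := by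
        field_simp
        ring
      rw [h10, Real.log_mul (by positivity) (by positivity)]
      have := Real.log_le_sub_one_of_pos
        (show 0 < 1 + ((c : ℝ) - T) / ((T : ℝ) - b) by positivity)
      linarith
    linarith
  have h10 := mul_le_mul_of_nonneg_left h9 (show 0 ≤ L by linarith)
  have h11 : L * (((c : ℝ) - T) / ((T : ℝ) - b)) ≤ (μ₂ - μ₁) ^ 2 * ((c : ℝ) - T) / 16 := by
    rw [← mul_div_assoc, div_le_div_iff₀ hu (by norm_num)]
    nlinarith
  have h12 : 0 < (μ₂ - μ₁) ^ 2 * ((c : ℝ) - T) := by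
    have : 0 < (μ₂ - μ₁) ^ 2 := by
      by_contra! hneg
      have : (μ₂ - μ₁) ^ 2 * ((T : ℝ) - b) ≤ 0 := mul_nonpos_of_nonpos_of_nonneg hneg hu.le
      linarith
    positivity
  -- In units of `Δ² (c - T)`: the gain `1 / 5` exceeds the removal error `1 / 32` plus the penalty
  -- excess `1 / 8`.
  linarith

theorem not_missed : ¬ MissedChangePoint n L q e δ K m d μ₁ μ₂ F W s T t l := by
  intro h
  obtain ⟨x₀, hx₀, hx₀s⟩ := h.exists_le
  obtain ⟨y₀, hy₀, hy₀t⟩ := h.exists_ge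
  obtain ⟨l₁, b, c, l₂, hl, hbT, hTc⟩ := exists_eq_append_cons_cons h.optimal.sorted h.not_mem
    ⟨x₀, hx₀, by have := h.lt_left; omega⟩ ⟨y₀, hy₀, by have := h.lt_right; omega⟩
  rcases le_total ((c : ℝ) - T) ((T : ℝ) - b) with hle | hle
  · exact h.false_of_right_closer hl hbT hTc hle
  · refine h.reflect.false_of_right_closer (l₁ := (l₂.map Neg.neg).reverse)
      (l₂ := (l₁.map Neg.neg).reverse) (b := -c) (c := -b) (by rw [hl]; simp) (by omega)
      (by omega) ?_
    push_cast
    linarith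

end MissedChangePoint

/-! ### From the statistical model to the deterministic configuration. -/

section Translation

variable {n : ℕ}

theorem prefixSum_succ (v : Fin n → ℝ) (i : Fin n) :
    prefixSum v ((i : ℤ) + 2) = prefixSum v ((i : ℤ) + 1) + v i := by
  have h1 : segmentSum v ((i : ℕ) + 1) ((i : ℕ) + 2) = v i := by
    rw [segmentSum, Finset.sum_eq_single i]
    · exact if_pos ⟨le_rfl, by omega⟩
    · intro j _ hj
      refine if_neg fun h => hj (Fin.ext ?_)
      have := h.1
      have := h.2
      omega
    · intro h; exact absurd (Finset.mem_univ i) h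
  rw [segmentSum_eq_prefixSum_sub v (by omega)] at h1
  push_cast at h1
  linarith

theorem cusum_sq (v : Fin n → ℝ) {a b c : ℕ} (hab : a < b) (hbc : b < c) :
    cusum v a b c ^ 2 = cusumSq (prefixSum v) a b c := by
  have h1 : (a : ℝ) < b := by exact_mod_cast hab
  have h2 : (b : ℝ) < c := by exact_mod_cast hbc
  rw [cusum, mul_pow, Real.sq_sqrt (div_nonneg (mul_nonneg (by linarith) (by linarith))
    (by linarith)), segmentSum_eq_prefixSum_sub v hab.le, segmentSum_eq_prefixSum_sub v hbc.le,
    cusumSq]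
  push_cast
  rfl

theorem psi_sq {q : ℝ} (hq : 0 ≤ q) {a b c : ℕ} (hab : a < b) (hbc : b < c) (ha : 1 ≤ a)
    (hc : c ≤ n + 1) : psi n q a b c ^ 2 = triadPenalty n q a b c := by
  have h1 : (a : ℝ) < b := by exact_mod_cast hab
  have h2 : (b : ℝ) < c := by exact_mod_cast hbc
  have hn : (c : ℝ) - b ≤ n := by
    have h3 : (c : ℝ) ≤ n + 1 := by exact_mod_cast hc
    have h4 : (1 : ℝ) ≤ b := by exact_mod_cast (by omega : 1 ≤ b)
    linarith
  have h0 := le_triadPenalty_right (q := q) (n := n) (by linarith) (a := a) (b := b) (c := c)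
    (by omega) (by omega)
  push_cast at h0
  have h5 := log_div_nonneg_of_le (n := n) (u := (c : ℝ) - b) (by linarith) hn
  rw [psi, Real.sq_sqrt]
  · rfl
  · have : 0 ≤ triadPenalty n q a b c := by linarith
    exact this

theorem HasChangePoints.segmentSum_add {θ : Fin n → ℝ} {τ : ChangePointVector n}
    {m : Fin (τ.len + 1) → ℝ} (h : HasChangePoints θ τ m) (w : Fin n → ℝ) (k : Fin (τ.len + 1))
    {a b : ℕ} (ha : τ.pos k.castSucc ≤ a) (hab : a ≤ b) (hb : b ≤ τ.pos k.succ) :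
    prefixSum (fun i => θ i + w i) b - prefixSum (fun i => θ i + w i) a =
      m k * ((b : ℝ) - a) + (prefixSum w b - prefixSum w a) := by
  rw [← segmentSum_eq_prefixSum_sub _ hab, ← segmentSum_eq_prefixSum_sub _ hab]
  have h1 := ChangePointVector.segmentSum_const (n := n) (m k) ((τ.one_le_pos _).trans ha) hab
    (hb.trans (τ.pos_le _))
  have h2 := ChangePointVector.segmentSum_sub (fun i => θ i + w i) w a b
  have h3 : segmentSum (fun i => θ i + w i - w i) a b = segmentSum (fun _ : Fin n => m k) a b := by
    refine ChangePointVector.segmentSum_congr fun i hi => ?_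
    rw [add_sub_cancel_right, h.eq_sum i]
    exact τ.sum_ite_segment m ⟨ha.trans hi.1, hi.2.trans_le hb⟩
  linarith

theorem ChangePointVector.le_of_mem_toList {τ : ChangePointVector n} {T : ℕ} {d : ℝ}
    (h : ENNReal.ofReal d ≤ distTo τ T) {p : ℤ} (hp : p ∈ τ.toList) (h1 : 1 < p)
    (hn : p < n + 1) : d ≤ |(p : ℝ) - (T : ℤ)| := by
  rw [ChangePointVector.toList, List.mem_ofFn] at hp
  obtain ⟨i, rfl⟩ := hp
  have hi0 : i ≠ 0 := by
    rintro rfl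
    rw [τ.pos_zero] at h1
    simp at h1
  have hil : i ≠ Fin.last (τ.len + 1) := by
    rintro rfl
    rw [τ.pos_last] at hn
    simp at hn
  have hi0' : (i : ℕ) ≠ 0 := fun h => hi0 (Fin.ext h)
  have hil' : (i : ℕ) ≠ τ.len + 1 := fun h => hil (Fin.ext h)
  have hlt := i.isLt
  have h2 := h.trans (iInf_le _ (⟨(i : ℕ) - 1, by omega⟩ : Fin τ.len))
  rw [ENNReal.ofReal_le_ofReal_iff (abs_nonneg _)] at h2
  have h3 : τ.point ⟨(i : ℕ) - 1, by omega⟩ = τ.pos i := by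
    rw [ChangePointVector.point]
    congr 1
    ext
    simp
    omega
  rw [h3] at h2
  simpa using h2

variable {Ω : Type*} [MeasurableSpace Ω] {P : Measure Ω}

theorem IsNoise.measureReal_right_le [IsProbabilityMeasure P] {ε : Fin n → Ω → ℝ}
    (h : IsNoise P ε) {T : ℕ} (hT : 1 ≤ T) (hTn : T ≤ n) {a d : ℝ} (ha : 0 ≤ a) :
    P.real {ω | ∃ j ≤ n + 1 - T, d ≤ j ∧ a * j <
      |prefixSum (fun i => ε i ω) ((T : ℤ) + j) - prefixSum (fun i => ε i ω) T|} ≤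
      2 * Real.exp (-(a ^ 2 * d / 2)) := by
  -- Enumerates the times `T, T + 1, …`, time `u` being coordinate `u - 1`; the default is never
  -- reached for `l < n + 1 - T`.
  set e : ℕ → Fin n := fun l => if h : T - 1 + l < n then ⟨T - 1 + l, h⟩ else ⟨0, by omega⟩ with he
  have hel : ∀ l < n + 1 - T, (e l : ℕ) = T - 1 + l := fun l hl => by
    rw [he]
    simp only
    rw [dif_pos (by omega)]
  have hinj : Set.InjOn e (Set.Iio (n + 1 - T)) := by
    intro l hl l' hl' heq
    have := hel l hl
    have := hel l' hl'
    rw [heq] at *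
    omega
  have hsum : ∀ ω, ∀ j ≤ n + 1 - T, prefixSum (fun i => ε i ω) ((T : ℤ) + j) -
      prefixSum (fun i => ε i ω) T = ∑ l ∈ Finset.range j, ε (e l) ω := by
    intro ω j
    induction j with
    | zero => simp
    | succ j ih =>
      intro hj
      rw [Finset.sum_range_succ, ← ih (by omega)]
      have h1 := prefixSum_succ (fun i => ε i ω) (e j)
      rw [hel j (by omega)] at h1
      rw [show ((T - 1 + j : ℕ) : ℤ) + 2 = T + (j + 1 : ℕ) by omega,
        show ((T - 1 + j : ℕ) : ℤ) + 1 = T + j by omega] at h1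
      rw [h1]
      ring
  refine le_trans (measureReal_mono ?_) (measureReal_exists_abs_sum_ge_le h.measurable h.indep
    h.subgaussian e hinj a d ha)
  rintro ω ⟨j, hj, hd, hlt⟩
  exact ⟨j, hj, hd, by rwa [hsum ω j hj] at hlt⟩

theorem IsNoise.measureReal_left_le [IsProbabilityMeasure P] {ε : Fin n → Ω → ℝ}
    (h : IsNoise P ε) {T : ℕ} (hT : 1 ≤ T) (hTn : T ≤ n) {a d : ℝ} (ha : 0 ≤ a) :
    P.real {ω | ∃ j ≤ T - 1, d ≤ j ∧ a * j <
      |prefixSum (fun i => ε i ω) T - prefixSum (fun i => ε i ω) ((T : ℤ) - j)|} ≤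
      2 * Real.exp (-(a ^ 2 * d / 2)) := by
  -- Enumerates the times `T - 1, T - 2, …` backwards; the subtraction does not truncate for `l < T
  -- - 1`.
  set e : ℕ → Fin n := fun l => ⟨T - 2 - l, by omega⟩ with he
  have hinj : Set.InjOn e (Set.Iio (T - 1)) := by
    intro l hl l' hl' heq
    have := congrArg Fin.val heq
    simp only [he, Set.mem_Iio] at this hl hl'
    omega
  have hsum : ∀ ω, ∀ j ≤ T - 1, prefixSum (fun i => ε i ω) T -
      prefixSum (fun i => ε i ω) ((T : ℤ) - j) = ∑ l ∈ Finset.range j, ε (e l) ω := by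
    intro ω j
    induction j with
    | zero => simp
    | succ j ih =>
      intro hj
      rw [Finset.sum_range_succ, ← ih (by omega)]
      have h1 := prefixSum_succ (fun i => ε i ω) (e j)
      rw [show ((e j : ℕ) : ℤ) + 2 = T - j by simp only [he]; omega,
        show ((e j : ℕ) : ℤ) + 1 = T - (j + 1 : ℕ) by simp only [he]; omega] at h1
      rw [h1]
      ring
  refine le_trans (measureReal_mono ?_) (measureReal_exists_abs_sum_ge_le h.measurable h.indep
    h.subgaussian e hinj a d ha)
  rintro ω ⟨j, hj, hd, hlt⟩
  exact ⟨j, hj, hd, by rwa [hsum ω j hj] at hlt⟩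

theorem ell_nonneg (L : ℝ) : 0 ≤ ell L :=
  le_min (by positivity) (by norm_num)

theorem ell_sq_lt {L : ℝ} (hL : 1 < L) : ell L ^ 2 < L := by
  have h1 : 1 < √L := by rw [Real.lt_sqrt] <;> linarith
  have h2 : ell L < √L := (min_le_left _ _).trans_lt (by linarith)
  calc ell L ^ 2 < √L ^ 2 := pow_lt_pow_left₀ h2 (ell_nonneg L) (by norm_num)
    _ = L := Real.sq_sqrt (by linarith)

/-- Without noise the squared CUSUM is `Δ² u v / (u + v) ≤ Δ² min u v`, and the triad penalty
dominates that of the shorter segment. -/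
theorem IsHighEnergy.le_sq_mul_min {κ q : ℝ} (hκ : 1 < κ) (hq : 0 < q) {θ : Fin n → ℝ}
    {τ : ChangePointVector n} {m : Fin (τ.len + 1) → ℝ} (hθ : HasChangePoints θ τ m)
    {k : Fin τ.len} (h : IsHighEnergy κ q θ τ k) {r : ℝ}
    (hr : r = min ((τ.point k : ℝ) - τ.prev k) ((τ.next k : ℝ) - τ.point k)) :
    κ * (2 * Real.log (n / r) + q) ≤ height m k ^ 2 * r := by
  have hsT : τ.prev k < τ.point k := τ.strictMono (by simp [Fin.lt_def])
  have hTt : τ.point k < τ.next k := τ.strictMono (by simp [Fin.lt_def])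
  have hs1 : 1 ≤ τ.prev k := τ.one_le_pos _
  have htn : τ.next k ≤ n + 1 := τ.pos_le _
  have e1 := hθ.segmentSum_add 0 k.castSucc (a := τ.prev k) (b := τ.point k) le_rfl hsT.le le_rfl
  have e2 := hθ.segmentSum_add 0 k.succ (a := τ.point k) (b := τ.next k) le_rfl hTt.le le_rfl
  have hcs := cusum_sq θ hsT hTt
  have hps := psi_sq (n := n) hq.le hsT hTt hs1 htn
  have hp0 : 0 ≤ psi n q (τ.prev k) (τ.point k) (τ.next k) := Real.sqrt_nonneg _
  unfold IsHighEnergy energy at h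
  have h1 : κ * triadPenalty n q (τ.prev k) (τ.point k) (τ.next k) ≤
      cusumSq (prefixSum θ) (τ.prev k) (τ.point k) (τ.next k) := by
    rw [← hcs, ← hps, ← sq_abs (cusum _ _ _ _)]
    nlinarith [mul_nonneg (by linarith : 0 ≤ κ) hp0]
  have hlow := le_triadPenalty_left (q := q) (n := n) (a := τ.prev k) (b := τ.point k)
    (c := τ.next k) (by norm_cast; omega) (by omega) (by omega)
  have hlow' := le_triadPenalty_right (q := q) (n := n) (a := τ.prev k) (b := τ.point k)
    (c := τ.next k) (by norm_cast; omega) (by omega) (by omega)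
  have h2 : 2 * Real.log (n / r) + q ≤ triadPenalty n q (τ.prev k) (τ.point k) (τ.next k) := by
    rw [hr]
    rcases min_choice ((τ.point k : ℝ) - τ.prev k) ((τ.next k : ℝ) - τ.point k) with h3 | h3
    · rw [h3]; exact_mod_cast hlow
    · rw [h3]; exact_mod_cast hlow'
  have hsT' : (τ.prev k : ℝ) < τ.point k := by exact_mod_cast hsT
  have hTt' : (τ.point k : ℝ) < τ.next k := by exact_mod_cast hTt
  have h3 : cusumSq (prefixSum θ) (τ.prev k) (τ.point k) (τ.next k) ≤ height m k ^ 2 * r := by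
    have z : ∀ t, prefixSum (0 : Fin n → ℝ) t = 0 := fun t => by simp [prefixSum]
    simp only [Pi.zero_apply, add_zero, z, sub_zero] at e1 e2
    unfold cusumSq
    rw [e1, e2]
    push_cast
    rw [mul_div_cancel_right₀ _ (by linarith), mul_div_cancel_right₀ _ (by linarith)]
    refine mul_le_mul_of_nonneg_left ?_ (sq_nonneg _)
    rw [hr, le_min_iff, div_le_iff₀ (by linarith), div_le_iff₀ (by linarith)]
    constructor <;> nlinarith
  exact (mul_le_mul_of_nonneg_left h2 (by linarith)).trans (h1.trans h3)

end Translation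

/-- The fraction of the segment length within which a high-energy change-point is first located. -/
noncomputable def localizationRatio (L : ℝ) : ℝ := Real.exp (-(L / (L - ell L ^ 2) + 4))

/-- The energy threshold `κ_L`. -/
noncomputable def energyThreshold (L : ℝ) : ℝ :=
  16000 * L + 32 * L * (1 + 2 * Real.log (2 / localizationRatio L)) / localizationRatio L

theorem localizationRatio_pos (L : ℝ) : 0 < localizationRatio L := Real.exp_pos _

theorem localizationRatio_le {L : ℝ} (hL : 1 < L) : localizationRatio L ≤ 1 / 16 := by
  have h1 : 0 ≤ L / (L - ell L ^ 2) := div_nonneg (by linarith) (by linarith [ell_sq_lt hL])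
  have h2 : localizationRatio L ≤ Real.exp (-4) := Real.exp_le_exp.2 (by linarith)
  refine h2.trans ?_
  rw [Real.exp_neg, ← one_div]
  refine one_div_le_one_div_of_le (by norm_num) ?_
  have h3 : Real.exp 4 = Real.exp 1 ^ 4 := by rw [← Real.exp_nat_mul]; norm_num
  rw [h3]
  calc (16 : ℝ) = 2 ^ 4 := by norm_num
    _ ≤ Real.exp 1 ^ 4 := pow_le_pow_left₀ (by norm_num) (by linarith [Real.exp_one_gt_d9]) 4

/-- The reason for `L / (L - ell L ^ 2)` in the exponent; the added 4 serves the bound by `1 / 16`.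
-/
theorem le_mul_log_localizationRatio {L : ℝ} (hL : 1 < L) :
    L ≤ (L - ell L ^ 2) * Real.log (1 / localizationRatio L) := by
  have h1 := ell_sq_lt hL
  have h2 : (L - ell L ^ 2) * (L / (L - ell L ^ 2)) = L := mul_div_cancel₀ _ (by linarith)
  rw [localizationRatio, one_div, ← Real.exp_neg, neg_neg, Real.log_exp, mul_add, h2]
  linarith

theorem log_two_div_localizationRatio_nonneg {L : ℝ} (hL : 1 < L) :
    0 ≤ Real.log (2 / localizationRatio L) :=
  log_div_nonneg_of_le (localizationRatio_pos L) (by linarith [localizationRatio_le hL])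

theorem le_energyThreshold {L : ℝ} (hL : 1 < L) : 16000 * L ≤ energyThreshold L := by
  have h1 := log_two_div_localizationRatio_nonneg hL
  have h2 := localizationRatio_pos L
  have : 0 ≤ 32 * L * (1 + 2 * Real.log (2 / localizationRatio L)) / localizationRatio L := by
    positivity
  rw [energyThreshold]
  linarith

theorem le_energyThreshold_mul {L : ℝ} (hL : 1 < L) :
    32 * L * (1 + 2 * Real.log (2 / localizationRatio L)) ≤
      energyThreshold L * localizationRatio L := by
  have h2 := localizationRatio_pos L
  rw [energyThreshold, add_mul, div_mul_cancel₀ _ h2.ne']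
  have : 0 ≤ 16000 * L * localizationRatio L := by positivity
  linarith

theorem proposition10 :
    ∃ q₀ c₁ c c' : ℝ, 0 < q₀ ∧ 0 < c₁ ∧ 0 < c ∧ 0 < c' ∧
      ∀ L : ℝ, 1 < L → ∃ κ : ℝ, 1 < κ ∧
        ∀ q : ℝ, q₀ + c₁ * Real.log ((min L 2 - 1)⁻¹) < q →
        ∀ (n : ℕ) (θ : Fin n → ℝ) (τ : ChangePointVector n) (m : Fin (τ.len + 1) → ℝ),
          HasChangePoints θ τ m →
        ∀ (Ω : Type*) [MeasurableSpace Ω] (P : Measure Ω) [IsProbabilityMeasure P]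
          (ε : Fin n → Ω → ℝ), IsNoise P ε →
        ∀ τhat : Ω → ChangePointVector n,
          (∀ ω, IsPenalizedLeastSquares L q (fun i => θ i + ε i ω) (τhat ω)) →
        ∀ k : Fin τ.len, IsHighEnergy κ q θ τ k →
        ∀ x : ℝ, (1 + max (Real.log (L - 1)) 0 ≤ x ∨ 1 + max (Real.log ((L - 1)⁻¹)) 0 ≤ x) →
          P.real {ω | ENNReal.ofReal (c * x / (height m k) ^ 2) ≤
              (goodEvent L q ε).indicator (fun ω => distTo (τhat ω) (τ.point k)) ω}
            ≤ c' * Real.exp (-x) := by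
  -- `3200 = 2 * 40²` turns the exponent `(|Δ| / 40)² d / 2` into `x`; the 4 counts two sides of `T`
  -- and two signs.
  refine ⟨3, 1, 3200, 4, by norm_num, by norm_num, by norm_num, by norm_num, ?_⟩
  intro L hL
  refine ⟨energyThreshold L, by linarith [le_energyThreshold hL], ?_⟩
  intro q hq n θ τ m hθ Ω _ P _ ε hε τhat hτhat k hk x hx
  have hq3 : 3 < q := by
    have h1 : 0 < min L 2 - 1 := by
      have : 1 < min L 2 := lt_min hL (by norm_num)
      linarith
    have h2 : 0 ≤ Real.log ((min L 2 - 1)⁻¹) :=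
      Real.log_nonneg ((one_le_inv₀ h1).2 (by linarith [min_le_right L 2]))
    linarith
  have hx1 : 1 ≤ x := by
    rcases hx with h | h <;> linarith [le_max_right (Real.log (L - 1)) 0,
      le_max_right (Real.log ((L - 1)⁻¹)) 0]
  have hsT : τ.prev k < τ.point k := τ.strictMono (by simp [Fin.lt_def])
  have hTt : τ.point k < τ.next k := τ.strictMono (by simp [Fin.lt_def])
  have hs1 : 1 ≤ τ.prev k := τ.one_le_pos _
  have htn : τ.next k ≤ n + 1 := τ.pos_le _
  have hE := hk.le_sq_mul_min (by linarith [le_energyThreshold hL]) (by linarith) hθ rfl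
  set s := τ.prev k with hs
  set T := τ.point k with hT
  set t := τ.next k with ht
  set Δ := height m k with hΔdef
  have hΔ0 : Δ ≠ 0 := sub_ne_zero.2 (hθ.ne k).symm
  have hΔ2 : 0 < Δ ^ 2 := by positivity
  set d := 3200 * x / Δ ^ 2 with hd
  have hd0 : 0 < d := by positivity
  have hexp : (1 / 40 * |Δ|) ^ 2 * d / 2 = x := by
    rw [mul_pow, sq_abs, hd]
    field_simp
    norm_num
  have hright := hε.measureReal_right_le (T := T) (by omega) (by omega) (a := 1 / 40 * |Δ|)
    (d := d) (by positivity)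
  have hleft := hε.measureReal_left_le (T := T) (by omega) (by omega) (a := 1 / 40 * |Δ|)
    (d := d) (by positivity)
  rw [hexp] at hright hleft
  set ER := {ω | ∃ j ≤ n + 1 - T, d ≤ j ∧ 1 / 40 * |Δ| * j <
    |prefixSum (fun i => ε i ω) ((T : ℤ) + j) - prefixSum (fun i => ε i ω) T|} with hER
  set EL := {ω | ∃ j ≤ T - 1, d ≤ j ∧ 1 / 40 * |Δ| * j <
    |prefixSum (fun i => ε i ω) T - prefixSum (fun i => ε i ω) ((T : ℤ) - j)|} with hEL
  have hsub : {ω | ENNReal.ofReal d ≤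
      (goodEvent L q ε).indicator (fun ω => distTo (τhat ω) T) ω} ⊆ ER ∪ EL := by
    intro ω hω
    by_contra hnot
    rw [Set.mem_union, not_or] at hnot
    obtain ⟨hnR, hnL⟩ := hnot
    -- Off the good event the indicator vanishes, while `d > 0`.
    have hgood : ω ∈ goodEvent L q ε := by
      by_contra hng
      have hω' : ENNReal.ofReal d ≤
        (goodEvent L q ε).indicator (fun ω => distTo (τhat ω) T) ω := hω
      rw [Set.indicator_of_notMem hng] at hω'
      simp only [nonpos_iff_eq_zero, ENNReal.ofReal_eq_zero] at hω'
      linarith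
    have hdist : ENNReal.ofReal d ≤ distTo (τhat ω) T := by
      have hω' : ENNReal.ofReal d ≤
        (goodEvent L q ε).indicator (fun ω => distTo (τhat ω) T) ω := hω
      rwa [Set.indicator_of_mem hgood] at hω'
    have hsT' : (s : ℝ) + 1 ≤ T := by exact_mod_cast hsT
    have hTt' : (T : ℝ) + 1 ≤ t := by exact_mod_cast hTt
    refine MissedChangePoint.not_missed (n := n) (L := L) (q := q) (e := ell L)
      (δ := localizationRatio L) (K := energyThreshold L)
      (m := min ((T : ℝ) - s) ((t : ℝ) - T)) (d := d) (μ₁ := m k.castSucc) (μ₂ := m k.succ)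
      (F := prefixSum fun i => θ i + ε i ω) (W := prefixSum fun i => ε i ω) (s := s) (T := T)
      (t := t) (l := (τhat ω).toList) ?_
    refine
      { one_lt_L := hL
        lt_q := hq3
        sq_lt := ell_sq_lt hL
        delta_pos := localizationRatio_pos L
        delta_le := localizationRatio_le hL
        le_log_delta := le_mul_log_localizationRatio hL
        le_K := le_energyThreshold hL
        le_K_mul := le_energyThreshold_mul hL
        lt_left := by omega
        lt_right := by omega
        sub_le_n := ?_
        one_le_m := le_min (by linarith) (by linarith)
        m_le_left := by push_cast; exact min_le_left _ _
        m_le_right := by push_cast; exact min_le_right _ _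
        energy_ge := hE
        optimal := (hτhat ω).isLocallyOptimal
        exists_le := ⟨1, List.mem_of_mem_head? (by rw [(τhat ω).head?_toList]; simp), by omega⟩
        exists_ge := ⟨n + 1, List.mem_of_mem_getLast? (by rw [(τhat ω).getLast?_toList]; simp),
          by omega⟩
        eq_left := ?_
        eq_right := ?_
        cusumSq_le := ?_
        abs_left_le := ?_
        abs_right_le := ?_
        d_pos := hd0
        le_dist := fun p hp h1 h2 =>
          ChangePointVector.le_of_mem_toList hdist hp (by omega) (by omega) }
    · have h1 : (t : ℝ) ≤ n + 1 := by exact_mod_cast htn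
      have h2 : (1 : ℝ) ≤ s := by exact_mod_cast hs1
      push_cast
      linarith
    · intro a h1 h2
      lift a to ℕ using by omega
      have := hθ.segmentSum_add (fun i => ε i ω) k.castSucc (a := a) (b := T)
        (by exact_mod_cast h1) (by exact_mod_cast h2) le_rfl
      exact_mod_cast this
    · intro a h1 h2
      lift a to ℕ using by omega
      have := hθ.segmentSum_add (fun i => ε i ω) k.succ (a := T) (b := a)
        le_rfl (by exact_mod_cast h1) (by exact_mod_cast h2)
      exact_mod_cast this
    · intro a b c h1 h2 h3 h4
      lift a to ℕ using by omega
      lift b to ℕ using by omega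
      lift c to ℕ using by omega
      have h5 := hgood a b c (by omega) (by omega) (by omega) (by omega)
      rw [← cusum_sq _ (by omega) (by omega), ← psi_sq (by linarith) (by omega) (by omega)
        (by omega) (by omega), ← mul_pow, ← sq_abs]
      exact pow_le_pow_left₀ (abs_nonneg _) h5 2
    -- A violation at `a` would put `ω` in `EL`, with `j = T - a`.
    · intro a h1 h2
      by_contra! hlt
      have haT : (a : ℝ) < (T : ℤ) := by linarith
      have haT' : a < T := by exact_mod_cast haT
      have hcast : (((T : ℤ) - a).toNat : ℤ) = T - a := Int.toNat_of_nonneg (by omega)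
      have hcast' : (((T : ℤ) - a).toNat : ℝ) = ((T : ℤ) : ℝ) - a := by exact_mod_cast hcast
      refine hnL ⟨((T : ℤ) - a).toNat, by omega, by rwa [hcast'], ?_⟩
      rw [hcast', hcast, sub_sub_cancel]
      exact hlt
    · intro a h1 h2
      by_contra! hlt
      have haT : ((T : ℤ) : ℝ) < a := by linarith
      have haT' : T < a := by exact_mod_cast haT
      have hcast : ((a - T).toNat : ℤ) = a - T := Int.toNat_of_nonneg (by omega)
      have hcast' : ((a - T).toNat : ℝ) = (a : ℝ) - (T : ℤ) := by exact_mod_cast hcast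
      refine hnR ⟨(a - T).toNat, by omega, by rwa [hcast'], ?_⟩
      rw [hcast', hcast, add_sub_cancel]
      exact hlt
  calc _ ≤ P.real (ER ∪ EL) := measureReal_mono hsub
    _ ≤ P.real ER + P.real EL := measureReal_union_le _ _
    _ ≤ 4 * Real.exp (-x) := by linarith
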